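/- **Setting.** Let $X\neq\{0\}$ be a (complex, not necessarily unital) C*-algebra and $\mathcal F$ a norm-closed linear subspace of $X^*$ such that: (b) $\|x\|=\sup\{|\varphi(x)|:\varphi\in\mathcal F,\ \|\varphi\|\le 1\}$ for $x\in X$; (c) $\|\varphi\|=\sup\{|\varphi(x)|:\|x\|\le1\}$ for $\varphi\in\mathcal F$; (d) the convex hull of every relatively $\sigma(X,\mathcal F)$-compact subset of $X$ is relatively $\sigma(X,\mathcal F)$-compact; (e) the convex hull of every relatively $\sigma(\mathcal F,X)$-compact subset of $\mathcal F$ is relatively $\sigma(\mathcal F,X)$-compact; (f) the involution of $X$ is $\mathcal F$-continuous and the multiplication of $X$ is separately $\mathcal F$-continuous. Here the $\mathcal F$-topology is $\sigma(X,\mathcal F)$. Let $G$ be a compact Hausdorff group with normalized Haar measure $dg$, and let $\alpha:G\to\mathrm{Aut}(X)$ be a homomorphism into the group of $\mathcal F$-continuous $*$-automorphisms of $X$ such that $g\mapsto\varphi(\alpha_g(x))$ is continuous for all $x\in X$, $\varphi\in\mathcal F$. (So $(X,G,\alpha)$ is an $\mathcal F$-dynamical system with $G$ compact.) Let $\widehat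 G$ be the set of unitary equivalence classes of irreducible continuous unitary representations of $G$; for each class fix a representative $\pi$ on a Hilbert space $H_\pi$ of finite dimension $d_\pi$, written as a unitary matrix $[\pi_{ij}]$ in an orthonormal basis. Put $\chi_\pi(g)=d_\pi\sum_i\overline{\pi_{ii}(g)}$ and $$X_1(\pi)=\Big\{x\in X:\ x=\int_G\chi_\pi(g)\,\alpha_g(x)\,dg\Big\},$$ the integral being weak, i.e. tested against every $\varphi\in\mathcal F$. Let $sp(\alpha)=\{\pi\in\widehat G: X_1(\pi)\ne\{0\}\}$. For an $\alpha$-invariant $*$-subalgebra $Y\subset X$, identify $Y\otimes B(H_\pi)$ with the $d_\pi\times d_\pi$ matrices over $Y$. Let $(Y\otimes B(H_\pi))^{\alpha\otimes ad\pi}$ be the fixed point algebra of the action $a=[a_{ij}]\mapsto(1\otimes\pi_g)[\alpha_g(a_{ij})](1\otimes\pi_g^*)$, let $$Y_2(\pi)=\{a\in Y\otimes B(H_\pi):\ [\alpha_g(a_{ij})]=a(1\otimes\pi_g)\ \text{for all } g\in G\},$$ and let $Y_2(\pi)^*Y_2(\pi)$ be the linear span of the products $a^*b$ with $a,b\in Y_2(\pi)$.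 A two-sided ideal (not assumed closed) $I$ of an algebra $B$ is *essential* if $b\in B$, $bI=\{0\}$ imply $b=0$. A $*$-subalgebra $B$ of $X\otimes B(H_\pi)$ is *$\mathcal F$-prime* if every non-zero two-sided ideal of $B$ is essential in $B$; $X$ is *$\alpha$-prime* if every non-zero $\alpha$-invariant two-sided ideal of $X$ is essential in $X$. Let $\mathcal H^\alpha_\sigma(X)$ be the set of non-zero $\alpha$-invariant $\mathcal F$-closed hereditary C*-subalgebras of $X$. For $Y\in\mathcal H^\alpha_\sigma(X)$ let $sp_{\mathcal F}(\alpha|_Y)$ be the set of $\pi\in\widehat G$ for which the closure of $Y_2(\pi)^*Y_2(\pi)$ in the (entrywise) $\mathcal F\otimes B(H_\pi)^*$-topology is essential in $(Y\otimes B(H_\pi))^{\alpha\otimes ad\pi}$. The Connes spectrum is $$\Gamma_{\mathcal F}(\alpha)=\bigcap\{sp_{\mathcal F}(\alpha|_Y):Y\in\mathcal H^\alpha_\sigma(X)\}.$$ **Theorem.** The following conditions are equivalent: (i) $(X\otimes B(H_\pi))^{\alpha\otimes ad\pi}$ is $\mathcal F$-prime for all $\pi\in sp(\alpha)$; (ii)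 $X$ is $\alpha$-prime and $sp(\alpha)=\Gamma_{\mathcal F}(\alpha)$. -/

import Mathlib

open scoped Topology

noncomputable section

namespace CompactAction

/-! ### Dual pairs of Banach spaces and the `F`-topology -/

section DualPair

variable {X : Type*} [NonUnitalCStarAlgebra X]

/-- The canonical pairing `(x, φ) ↦ φ x` between `X` and a space `F` of bounded functionals. -/
def pairing (F : Submodule ℂ (StrongDual ℂ X)) : X →ₗ[ℂ] F →ₗ[ℂ] ℂ :=
  LinearMap.flip ((ContinuousLinearMap.coeLM ℂ).comp F.subtype)

/-- The `F`-topology on `X`, that is, the weak topology `σ(X, F)`. -/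
abbrev fTopology (F : Submodule ℂ (StrongDual ℂ X)) : TopologicalSpace X :=
  inferInstanceAs (TopologicalSpace (WeakBilin (pairing F)))

/-- The `X`-topology on `F`, that is, the weak topology `σ(F, X)`. -/
abbrev xTopology (F : Submodule ℂ (StrongDual ℂ X)) : TopologicalSpace F :=
  inferInstanceAs (TopologicalSpace (WeakBilin (pairing F).flip))

/-- `S` is relatively compact for the topology `t`: its `t`-closure is `t`-compact. -/
def IsRelCompact {E : Type*} (t : TopologicalSpace E) (S : Set E) : Prop :=
  @IsCompact E t (@closure E t S)

/-- `(X, F)` is a dual pair of Banach spaces, where `X` is a C*-algebra whose involution is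
`F`-continuous and whose multiplication is separately `F`-continuous. The space `F` carries the
norm of the dual of `X`. -/
structure IsDualPair (F : Submodule ℂ (StrongDual ℂ X)) : Prop where
  isClosed : IsClosed (F : Set (StrongDual ℂ X))
  norm_eq : ∀ x : X, IsLUB {r : ℝ | ∃ φ ∈ F, ‖φ‖ ≤ 1 ∧ r = ‖φ x‖} ‖x‖
  norm_functional_eq : ∀ φ ∈ F, IsLUB {r : ℝ | ∃ x : X, ‖x‖ ≤ 1 ∧ r = ‖φ x‖} ‖φ‖
  convexHull_relCompact : ∀ S : Set X,
    IsRelCompact (fTopology F) S → IsRelCompact (fTopology F) (convexHull ℝ S)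
  convexHull_relCompact_dual : ∀ S : Set F,
    IsRelCompact (xTopology F) S → IsRelCompact (xTopology F) (convexHull ℝ S)
  continuous_star : Continuous[fTopology F, fTopology F] (fun x : X => star x)
  continuous_mul_left : ∀ a : X, Continuous[fTopology F, fTopology F] (fun x : X => a * x)
  continuous_mul_right : ∀ a : X, Continuous[fTopology F, fTopology F] (fun x : X => x * a)

/-- `(X, G, α)` is an `F`-dynamical system: `(X, F)` is a dual pair, `G` acts on `X` by
`F`-continuous `*`-automorphisms, and all the functions `g ↦ φ (α_g x)`, `φ ∈ F`, `x ∈ X`, are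
continuous. -/
structure IsFDynamicalSystem {G : Type*} [Group G] [TopologicalSpace G]
    (F : Submodule ℂ (StrongDual ℂ X)) (α : G →* (X ≃⋆ₐ[ℂ] X)) : Prop where
  dualPair : IsDualPair F
  continuous_aut : ∀ g : G, Continuous[fTopology F, fTopology F] (fun x : X => α g x)
  continuous_orbit : ∀ φ ∈ F, ∀ x : X, Continuous (fun g : G => φ (α g x))

end DualPair

/-! ### Irreducible unitary representations and the dual of a compact group -/

section Representations

variable (G : Type*) [Group G] [TopologicalSpace G]

/-- A continuous irreducible unitary representation of `G` on the Hilbert space `ℂ^dim`, written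
with matrices (irreducible unitary representations of compact groups are finite dimensional). -/
structure IrrepMatrix where
  dim : ℕ
  toHom : G →* Matrix.unitaryGroup (Fin dim) ℂ
  continuous_toHom : Continuous toHom
  irreducible : Representation.IsIrreducible (k := ℂ) (G := G) (V := Fin dim → ℂ)
    ((Matrix.toLinAlgEquiv' (R := ℂ) (n := Fin dim) : _ →* _).comp
      ((Matrix.unitaryGroup (Fin dim) ℂ).subtype.comp toHom))

variable {G}

/-- The matrix `π_g`. -/
def IrrepMatrix.mat (π : IrrepMatrix G) (g : G) : Matrix (Fin π.dim) (Fin π.dim) ℂ :=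
  (π.toHom g : Matrix (Fin π.dim) (Fin π.dim) ℂ)

theorem IrrepMatrix.mat_star_mul (π : IrrepMatrix G) (g : G) : star (π.mat g) * π.mat g = 1 :=
  Unitary.star_mul_self_of_mem (π.toHom g).2

/-- Unitary equivalence of representations, by a unitary intertwiner `U`. -/
def UnitarilyEquivalent (π ρ : IrrepMatrix G) : Prop :=
  ∃ U : Matrix (Fin ρ.dim) (Fin π.dim) ℂ,
    U.conjTranspose * U = 1 ∧ U * U.conjTranspose = 1 ∧ ∀ g : G, U * π.mat g = ρ.mat g * U

theorem unitarilyEquivalent_equivalence :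
    Equivalence (UnitarilyEquivalent (G := G)) where
  refl π := ⟨1, by simp, by simp, fun g => by simp⟩
  symm := by
    rintro π ρ ⟨U, h1, h2, h3⟩
    refine ⟨U.conjTranspose, by simpa using h2, by simpa using h1, fun g => ?_⟩
    calc U.conjTranspose * ρ.mat g
        = U.conjTranspose * (ρ.mat g * U) * U.conjTranspose := by
          rw [Matrix.mul_assoc, Matrix.mul_assoc, h2, Matrix.mul_one]
      _ = π.mat g * U.conjTranspose := by
          rw [← h3, ← Matrix.mul_assoc, h1, Matrix.one_mul]
  trans := by
    rintro π ρ τ ⟨U, h1, h2, h3⟩ ⟨V, k1, k2, k3⟩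
    refine ⟨V * U, ?_, ?_, fun g => ?_⟩
    · rw [Matrix.conjTranspose_mul, Matrix.mul_assoc, ← Matrix.mul_assoc V.conjTranspose, k1,
        Matrix.one_mul, h1]
    · rw [Matrix.conjTranspose_mul, Matrix.mul_assoc, ← Matrix.mul_assoc U, h2, Matrix.one_mul, k2]
    · rw [Matrix.mul_assoc, h3, ← Matrix.mul_assoc, k3, Matrix.mul_assoc]

/-- The setoid of unitary equivalence. -/
def irrepSetoid (G : Type*) [Group G] [TopologicalSpace G] : Setoid (IrrepMatrix G) :=
  ⟨UnitarilyEquivalent, unitarilyEquivalent_equivalence⟩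

/-- The dual `Ĝ`: unitary equivalence classes of irreducible representations. -/
def GroupDual (G : Type*) [Group G] [TopologicalSpace G] : Type _ :=
  Quotient (irrepSetoid G)

/-- The fixed representative of a class in `Ĝ`. -/
def GroupDual.rep (π : GroupDual G) : IrrepMatrix G :=
  Quotient.out (s := irrepSetoid G) π

/-- The (normalized) character `χ_π(g) = d_π ∑ᵢ conj (π_ii(g))`. -/
def IrrepMatrix.chi (π : IrrepMatrix G) (g : G) : ℂ :=
  (π.dim : ℂ) * ∑ i, star (π.mat g i i)

end Representations

/-! ### Ideals, essential subsets, primeness -/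

section Ideals

variable {A : Type*} [NonUnitalRing A] [StarRing A] [Module ℂ A]

/-- `I` is a two-sided ideal (not necessarily closed) of the subalgebra `B` of `A`. -/
def IsTwoSidedIdealIn (B : NonUnitalStarSubalgebra ℂ A) (I : Submodule ℂ A) : Prop :=
  (∀ x ∈ I, x ∈ B) ∧ ∀ b ∈ B, ∀ x ∈ I, b * x ∈ I ∧ x * b ∈ I

/-- `I` is essential in `B`: the annihilator of `I` in `B` is trivial. (For self-adjoint `I`, and
for all two-sided ideals of C*-algebras, left and right annihilators vanish together.) -/
def IsEssentialIn (B : NonUnitalStarSubalgebra ℂ A) (I : Set A) : Prop :=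
  ∀ b ∈ B, (∀ x ∈ I, b * x = 0) → b = 0

/-- `B` is `F`-prime: every non-zero two-sided ideal of `B` is essential (that is, has trivial
annihilator). This condition does not involve `F`. -/
def IsFPrime (B : NonUnitalStarSubalgebra ℂ A) : Prop :=
  ∀ I : Submodule ℂ A, IsTwoSidedIdealIn B I → I ≠ ⊥ → IsEssentialIn B (I : Set A)

end Ideals

/-! ### The algebra `X ⊗ B(H_π)`, realized as the C*-algebra of matrices over `X` -/

section ScalarMatrices

variable {X : Type*} [NonUnitalCStarAlgebra X] {d : ℕ}

/-- `(1 ⊗ U) a` for a scalar matrix `U` and `a ∈ X ⊗ M_d(ℂ)`. -/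
def lmulScalar (U : Matrix (Fin d) (Fin d) ℂ) (a : CStarMatrix (Fin d) (Fin d) X) :
    CStarMatrix (Fin d) (Fin d) X :=
  CStarMatrix.ofMatrix fun i j => ∑ k, U i k • a k j

/-- `a (1 ⊗ U)` for a scalar matrix `U` and `a ∈ X ⊗ M_d(ℂ)`. -/
def rmulScalar (a : CStarMatrix (Fin d) (Fin d) X) (U : Matrix (Fin d) (Fin d) ℂ) :
    CStarMatrix (Fin d) (Fin d) X :=
  CStarMatrix.ofMatrix fun i j => ∑ k, U k j • a i k

/-- `β ⊗ ι` for an automorphism `β` of `X`: apply `β` to all the entries. -/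
def entrywise (β : X ≃⋆ₐ[ℂ] X) (a : CStarMatrix (Fin d) (Fin d) X) :
    CStarMatrix (Fin d) (Fin d) X :=
  CStarMatrix.ofMatrix fun i j => β (a i j)

variable (U V : Matrix (Fin d) (Fin d) ℂ) (a b : CStarMatrix (Fin d) (Fin d) X)
  (β : X ≃⋆ₐ[ℂ] X) (c : ℂ)

@[simp] theorem lmulScalar_apply (i j : Fin d) : lmulScalar U a i j = ∑ k, U i k • a k j := rfl

@[simp] theorem rmulScalar_apply (i j : Fin d) : rmulScalar a U i j = ∑ k, U k j • a i k := rfl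

@[simp] theorem entrywise_apply (i j : Fin d) : entrywise β a i j = β (a i j) := rfl

theorem lmulScalar_add : lmulScalar U (a + b) = lmulScalar U a + lmulScalar U b := by
  ext i j; simp [Finset.sum_add_distrib]

theorem rmulScalar_add : rmulScalar (a + b) U = rmulScalar a U + rmulScalar b U := by
  ext i j; simp [Finset.sum_add_distrib]

theorem entrywise_add : entrywise β (a + b) = entrywise β a + entrywise β b := by
  ext i j; simp

theorem lmulScalar_smul : lmulScalar U (c • a) = c • lmulScalar U a := by
  ext i j; simp [Finset.smul_sum, smul_comm c]

theorem rmulScalar_smul : rmulScalar (c • a) U = c • rmulScalar a U := by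
  ext i j; simp [Finset.smul_sum, smul_comm c]

theorem entrywise_smul : entrywise β (c • a) = c • entrywise β a := by
  ext i j; simp

@[simp] theorem lmulScalar_zero : lmulScalar U (0 : CStarMatrix (Fin d) (Fin d) X) = 0 := by
  ext i j; simp

@[simp] theorem rmulScalar_zero : rmulScalar (0 : CStarMatrix (Fin d) (Fin d) X) U = 0 := by
  ext i j; simp

@[simp] theorem entrywise_zero : entrywise β (0 : CStarMatrix (Fin d) (Fin d) X) = 0 := by
  ext i j; simp

theorem entrywise_mul : entrywise β (a * b) = entrywise β a * entrywise β b := by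
  ext i j; simp [CStarMatrix.mul_apply]

theorem entrywise_star : entrywise β (star a) = star (entrywise β a) := by
  ext i j; simp [CStarMatrix.star_apply, map_star]

theorem lmulScalar_mul : lmulScalar U (a * b) = lmulScalar U a * b := by
  ext i j
  simp only [lmulScalar_apply, CStarMatrix.mul_apply, Finset.smul_sum, Finset.sum_mul,
    smul_mul_assoc]
  exact Finset.sum_comm

theorem rmulScalar_mul : rmulScalar (a * b) U = a * rmulScalar b U := by
  ext i j
  simp only [rmulScalar_apply, CStarMatrix.mul_apply, Finset.smul_sum, Finset.mul_sum,
    mul_smul_comm]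
  exact Finset.sum_comm

theorem rmulScalar_mul_eq : rmulScalar a U * b = a * lmulScalar U b := by
  ext i j
  simp only [rmulScalar_apply, lmulScalar_apply, CStarMatrix.mul_apply, Finset.mul_sum,
    Finset.sum_mul, mul_smul_comm, smul_mul_assoc]
  exact Finset.sum_comm

theorem lmulScalar_lmulScalar : lmulScalar U (lmulScalar V a) = lmulScalar (U * V) a := by
  ext i j
  simp only [lmulScalar_apply, Matrix.mul_apply, Finset.smul_sum, Finset.sum_smul, smul_smul]
  exact Finset.sum_comm

theorem lmulScalar_one : lmulScalar 1 a = a := by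
  ext i j
  simp [Matrix.one_apply, ite_smul]

theorem lmulScalar_rmulScalar : lmulScalar U (rmulScalar a V) = rmulScalar (lmulScalar U a) V := by
  ext i j
  simp only [lmulScalar_apply, rmulScalar_apply, Finset.smul_sum, smul_smul, mul_comm]
  exact Finset.sum_comm

theorem star_lmulScalar : star (lmulScalar U a) = rmulScalar (star a) (star U) := by
  ext i j
  simp [CStarMatrix.star_apply, Matrix.star_apply]

theorem star_rmulScalar : star (rmulScalar a U) = lmulScalar (star U) (star a) := by
  ext i j
  simp [CStarMatrix.star_apply, Matrix.star_apply]

end ScalarMatrices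

/-! ### Spectral subspaces, fixed point algebras and spectra -/

section Spectra

variable {X : Type*} [NonUnitalCStarAlgebra X] {G : Type*} [Group G]

/-- `y` is the weak integral `∫ f(g) dg` with respect to the normalized Haar measure of `G`:
`φ y = ∫ φ (f g) dg` for every `φ ∈ F`. -/
def IsWeakIntegral [TopologicalSpace G] [IsTopologicalGroup G] [CompactSpace G]
    [MeasurableSpace G] [BorelSpace G] (F : Submodule ℂ (StrongDual ℂ X)) (f : G → X) (y : X) :
    Prop :=
  ∀ φ ∈ F, φ y = ∫ g, φ (f g) ∂(MeasureTheory.Measure.haarMeasure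
    (⊤ : TopologicalSpace.PositiveCompacts G))

/-- The spectral subspace `X₁(π) = {x : P_α(π)(x) = x}`, where `P_α(π)(x)` is the weak integral
`∫ χ_π(g) α_g(x) dg`. -/
def spectralSubspaceOne [TopologicalSpace G] [IsTopologicalGroup G] [CompactSpace G]
    [MeasurableSpace G] [BorelSpace G] (F : Submodule ℂ (StrongDual ℂ X))
    (α : G →* (X ≃⋆ₐ[ℂ] X)) (π : IrrepMatrix G) : Set X :=
  {x | IsWeakIntegral F (fun g => π.chi g • α g x) x}

variable [TopologicalSpace G]

/-- The action `α ⊗ ad π` on `X ⊗ B(H_π)`: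
`(α_g ⊗ ad π_g)(a) = (1 ⊗ π_g) [α_g(a_ij)] (1 ⊗ π_g*)`. -/
def adAction (α : G →* (X ≃⋆ₐ[ℂ] X)) (π : IrrepMatrix G) (g : G)
    (a : CStarMatrix (Fin π.dim) (Fin π.dim) X) : CStarMatrix (Fin π.dim) (Fin π.dim) X :=
  lmulScalar (π.mat g) (rmulScalar (entrywise (α g) a) (star (π.mat g)))

/-- The fixed point algebra `(Y ⊗ B(H_π))^{α ⊗ ad π}` for a `*`-subalgebra `Y` of `X`, as a
`*`-subalgebra of `X ⊗ B(H_π)`. -/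
def fixedAlgebra (α : G →* (X ≃⋆ₐ[ℂ] X)) (π : IrrepMatrix G) (Y : NonUnitalStarSubalgebra ℂ X) :
    NonUnitalStarSubalgebra ℂ (CStarMatrix (Fin π.dim) (Fin π.dim) X) where
  carrier := {a | (∀ i j, a i j ∈ Y) ∧ ∀ g : G, adAction α π g a = a}
  add_mem' := by
    rintro a b ⟨ha, ha'⟩ ⟨hb, hb'⟩
    refine ⟨fun i j => add_mem (ha i j) (hb i j), fun g => ?_⟩
    have h1 := ha' g
    have h2 := hb' g
    simp only [adAction] at h1 h2 ⊢
    rw [entrywise_add, rmulScalar_add, lmulScalar_add, h1, h2]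
  zero_mem' := ⟨fun i j => zero_mem Y, fun g => by simp [adAction]⟩
  mul_mem' := by
    rintro a b ⟨ha, ha'⟩ ⟨hb, hb'⟩
    refine ⟨fun i j => ?_, fun g => ?_⟩
    · rw [CStarMatrix.mul_apply]
      exact sum_mem fun k _ => mul_mem (ha i k) (hb k j)
    · have h1 := ha' g
      have h2 := hb' g
      simp only [adAction] at h1 h2 ⊢
      conv_rhs => rw [← h1, ← h2]
      rw [← lmulScalar_mul, rmulScalar_mul_eq, lmulScalar_lmulScalar, π.mat_star_mul,
        lmulScalar_one, entrywise_mul, rmulScalar_mul]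
  smul_mem' := by
    rintro c a ⟨ha, ha'⟩
    refine ⟨fun i j => SMulMemClass.smul_mem c (ha i j), fun g => ?_⟩
    have h1 := ha' g
    simp only [adAction] at h1 ⊢
    rw [entrywise_smul, rmulScalar_smul, lmulScalar_smul, h1]
  star_mem' := by
    rintro a ⟨ha, ha'⟩
    refine ⟨fun i j => ?_, fun g => ?_⟩
    · rw [CStarMatrix.star_apply]
      exact star_mem (ha j i)
    · have h1 := ha' g
      simp only [adAction] at h1 ⊢
      conv_rhs => rw [← h1]
      rw [star_lmulScalar, star_rmulScalar, star_star, entrywise_star, lmulScalar_rmulScalar]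

/-- The spectral subspace `Y₂(π) = {a ∈ Y ⊗ B(H_π) : (α_g ⊗ ι)(a) = a (1 ⊗ π_g) for all g}`. -/
def spectralSubspaceTwo (α : G →* (X ≃⋆ₐ[ℂ] X)) (π : IrrepMatrix G)
    (Y : NonUnitalStarSubalgebra ℂ X) : Set (CStarMatrix (Fin π.dim) (Fin π.dim) X) :=
  {a | (∀ i j, a i j ∈ Y) ∧ ∀ g : G, entrywise (α g) a = rmulScalar a (π.mat g)}

/-- The linear span `Y₂(π)* Y₂(π)` of the products `a* b`, `a, b ∈ Y₂(π)`. -/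
def spectralIdeal (α : G →* (X ≃⋆ₐ[ℂ] X)) (π : IrrepMatrix G)
    (Y : NonUnitalStarSubalgebra ℂ X) :
    Submodule ℂ (CStarMatrix (Fin π.dim) (Fin π.dim) X) :=
  Submodule.span ℂ
    {c | ∃ a ∈ spectralSubspaceTwo α π Y, ∃ b ∈ spectralSubspaceTwo α π Y, c = star a * b}

/-- The `F ⊗ B(H)*`-topology on `X ⊗ M_d(ℂ)`, that is, entrywise `F`-convergence. -/
@[reducible]
def matrixFTopology (F : Submodule ℂ (StrongDual ℂ X)) (d : ℕ) :
    TopologicalSpace (CStarMatrix (Fin d) (Fin d) X) :=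
  @Pi.topologicalSpace (Fin d) (fun _ => Fin d → X)
    (fun _ => @Pi.topologicalSpace (Fin d) (fun _ => X) (fun _ => fTopology F))

/-- The Arveson type spectrum `sp(α) = {π : X₁(π) ≠ {0}}`. -/
def spec [IsTopologicalGroup G] [CompactSpace G] [MeasurableSpace G] [BorelSpace G]
    (F : Submodule ℂ (StrongDual ℂ X)) (α : G →* (X ≃⋆ₐ[ℂ] X)) : Set (GroupDual G) :=
  {π | spectralSubspaceOne F α π.rep ≠ {0}}

/-- The spectrum `sp_F(α|_Y)`: those `π` for which the `F`-closure of `Y₂(π)* Y₂(π)` is essential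
in `(Y ⊗ B(H_π))^{α ⊗ ad π}`. It is used for `α`-invariant `F`-closed `Y`, so that closures in `Y`
and in `X` agree. -/
def specF (F : Submodule ℂ (StrongDual ℂ X)) (α : G →* (X ≃⋆ₐ[ℂ] X))
    (Y : NonUnitalStarSubalgebra ℂ X) : Set (GroupDual G) :=
  {π | IsEssentialIn (fixedAlgebra α π.rep Y)
    (@closure _ (matrixFTopology F π.rep.dim)
      (spectralIdeal α π.rep Y : Set (CStarMatrix (Fin π.rep.dim) (Fin π.rep.dim) X)))}

/-- `Y` belongs to `H_σ^α(X)`: it is a non-zero `α`-invariant `F`-closed hereditary C*-subalgebra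
of `X`. (An `F`-closed subspace is norm closed.) -/
structure IsInvariantHereditary [PartialOrder X] (F : Submodule ℂ (StrongDual ℂ X))
    (α : G →* (X ≃⋆ₐ[ℂ] X)) (Y : NonUnitalStarSubalgebra ℂ X) : Prop where
  nonzero : ∃ y ∈ Y, y ≠ 0
  invariant : ∀ g : G, ∀ y ∈ Y, α g y ∈ Y
  isClosed : @IsClosed X (fTopology F) (Y : Set X)
  hereditary : ∀ x y : X, 0 ≤ x → x ≤ y → y ∈ Y → x ∈ Y

/-- The Connes spectrum `Γ_F(α) = ⋂ {sp_F(α|_Y) : Y ∈ H_σ^α(X)}`. -/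
def connesSpectrum [PartialOrder X] (F : Submodule ℂ (StrongDual ℂ X))
    (α : G →* (X ≃⋆ₐ[ℂ] X)) : Set (GroupDual G) :=
  {π | ∀ Y : NonUnitalStarSubalgebra ℂ X, IsInvariantHereditary F α Y → π ∈ specF F α Y}

/-- `X` is `α`-prime: every non-zero `α`-invariant two-sided ideal of `X` is essential. -/
def IsActionPrime (α : G →* (X ≃⋆ₐ[ℂ] X)) : Prop :=
  ∀ I : Submodule ℂ X, IsTwoSidedIdealIn ⊤ I → (∀ g : G, ∀ x ∈ I, α g x ∈ I) → I ≠ ⊥ →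
    IsEssentialIn ⊤ (I : Set X)

end Spectra

end CompactAction

end

open CompactAction

/-!
The fixed point algebra `X^α` mediates between the two conditions. For `a, b ∈ X₂(π)` the product
`a b*` lies in `M_d(X^α)` while `a* b` lies in the fixed point algebra of `α ⊗ ad π`, so `X₂(π)`
acts like an imprimitivity bimodule and carries primeness back and forth, provided no nonzero
element of the latter algebra is annihilated by `X₂(π)`; this nondegeneracy, for all hereditary
subalgebras at once, is what membership in the Connes spectrum means. Primeness of `X^α` in turn
is the case of the trivial representation. It passes to `α`-primeness of `X` because by the
Peter–Weyl theorem the matrix entries of the spaces `X₂(π)` are `F`-total, whence every nonzero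
invariant `F`-closed subspace closed under `(y, z) ↦ y z*` has a nonzero fixed point. Conversely,
if `p X^α q = 0` with `p, q` fixed, then the Connes spectrum of the hereditary subalgebra
annihilated by `p X^α` forces `p X₂(π) q = 0` for all `π`, hence `p X q = 0`.
-/

open MeasureTheory

noncomputable section

namespace CompactAction

/-! ### Annihilators and primeness -/

section Annihilators

variable {A : Type*} [NonUnitalRing A] [Module ℂ A]

/-- The left annihilator `{x : x S = 0}` of a set `S`. -/
def leftAnnihilator [IsScalarTower ℂ A A] (S : Set A) : Submodule ℂ A where
  carrier := {x | ∀ s ∈ S, x * s = 0}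
  add_mem' hx hy s hs := by rw [add_mul, hx s hs, hy s hs, add_zero]
  zero_mem' s _ := zero_mul s
  smul_mem' c x hx s hs := by rw [smul_mul_assoc, hx s hs, smul_zero]

/-- The right annihilator `{x : S x = 0}` of a set `S`. -/
def rightAnnihilator [SMulCommClass ℂ A A] (S : Set A) : Submodule ℂ A where
  carrier := {x | ∀ s ∈ S, s * x = 0}
  add_mem' hx hy s hs := by rw [mul_add, hx s hs, hy s hs, add_zero]
  zero_mem' s _ := mul_zero s
  smul_mem' c x hx s hs := by rw [mul_smul_comm, hx s hs, smul_zero]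

theorem mem_leftAnnihilator [IsScalarTower ℂ A A] {S : Set A} {x : A} :
    x ∈ leftAnnihilator S ↔ ∀ s ∈ S, x * s = 0 := Iff.rfl

theorem mem_rightAnnihilator [SMulCommClass ℂ A A] {S : Set A} {x : A} :
    x ∈ rightAnnihilator S ↔ ∀ s ∈ S, s * x = 0 := Iff.rfl

variable [Star A] {G : Type*} [Group G] {α : G →* (A ≃⋆ₐ[ℂ] A)}

theorem apply_apply_inv (α : G →* (A ≃⋆ₐ[ℂ] A)) (g : G) (x : A) : α g (α g⁻¹ x) = x := by
  rw [← StarAlgEquiv.mul_apply, ← map_mul, mul_inv_cancel, map_one, StarAlgEquiv.one_apply]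

theorem map_mem_leftAnnihilator [IsScalarTower ℂ A A] {S : Set A} (hS : ∀ g, ∀ s ∈ S, α g s ∈ S)
    (g : G) {x : A} (hx : x ∈ leftAnnihilator S) : α g x ∈ leftAnnihilator S := fun s hs => by
  rw [← apply_apply_inv α g s, ← map_mul, hx _ (hS _ s hs), map_zero]

theorem map_mem_rightAnnihilator [SMulCommClass ℂ A A] {S : Set A}
    (hS : ∀ g, ∀ s ∈ S, α g s ∈ S) (g : G) {x : A} (hx : x ∈ rightAnnihilator S) :
    α g x ∈ rightAnnihilator S := fun s hs => by
  rw [← apply_apply_inv α g s, ← map_mul, hx _ (hS _ s hs), map_zero]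

end Annihilators

section Primeness

variable {A : Type*} [NonUnitalCStarAlgebra A] {B : NonUnitalStarSubalgebra ℂ A}

theorem mul_mul_star_self_eq_zero_iff {a b : A} : a * (b * star b) = 0 ↔ a * b = 0 := by
  refine ⟨fun h => ?_, fun h => by rw [← mul_assoc, h, zero_mul]⟩
  rw [← CStarRing.mul_star_self_eq_zero_iff]
  calc a * b * star (a * b) = a * (b * star b) * star a := by simp only [star_mul, mul_assoc]
    _ = 0 := by rw [h, zero_mul]

theorem isFPrime_iff :
    IsFPrime B ↔ ∀ a ∈ B, ∀ b ∈ B, (∀ c ∈ B, a * c * b = 0) → a = 0 ∨ b = 0 := by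
  constructor
  · intro hB a ha b hb hab
    by_contra! h0
    let I : Submodule ℂ A :=
      B.toNonUnitalSubalgebra.toSubmodule ⊓ rightAnnihilator {x | ∃ c ∈ B, x = a * c}
    have hI : IsTwoSidedIdealIn B I := by
      refine ⟨fun x hx => hx.1, fun d hd x hx => ⟨⟨B.mul_mem hd hx.1, ?_⟩, B.mul_mem hx.1 hd, ?_⟩⟩
      · rintro _ ⟨c, hc, rfl⟩
        rw [mul_assoc, ← mul_assoc c, ← mul_assoc]
        exact hx.2 _ ⟨_, mul_mem hc hd, rfl⟩
      · rintro s hs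
        rw [← mul_assoc, hx.2 s hs, zero_mul]
    have hbI : b ∈ I := ⟨hb, by rintro _ ⟨c, hc, rfl⟩; exact hab c hc⟩
    refine h0.1 ((CStarRing.mul_star_self_eq_zero_iff a).1 ?_)
    exact hB I hI (Submodule.ne_bot_iff I |>.2 ⟨b, hbI, h0.2⟩) _ (mul_mem ha (star_mem ha))
      fun x hx => hx.2 _ ⟨_, star_mem ha, rfl⟩
  · intro h I hI hI0 b hb hbI
    obtain ⟨x, hx, hx0⟩ := (Submodule.ne_bot_iff I).1 hI0
    refine (h b hb x (hI.1 x hx) fun c hc => ?_).resolve_right hx0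
    rw [mul_assoc]
    exact hbI _ (hI.2 c hc x hx).1

end Primeness

section MatrixPrimeness

variable {X : Type*} [NonUnitalCStarAlgebra X] {d : ℕ} {B : NonUnitalStarSubalgebra ℂ X}

/-- The element `p ⊗ 1` of `X ⊗ M_d(ℂ)`. -/
def diagonalOf (d : ℕ) (p : X) : CStarMatrix (Fin d) (Fin d) X :=
  CStarMatrix.ofMatrix (Matrix.diagonal fun _ => p)

theorem diagonalOf_apply (p : X) (i j : Fin d) :
    diagonalOf d p i j = if i = j then p else 0 := rfl

theorem diagonalOf_mul_apply (p : X) (a : CStarMatrix (Fin d) (Fin d) X) (i j : Fin d) :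
    (diagonalOf d p * a) i j = p * a i j := by
  simp [CStarMatrix.mul_apply, diagonalOf_apply]

theorem mul_diagonalOf_apply (p : X) (a : CStarMatrix (Fin d) (Fin d) X) (i j : Fin d) :
    (a * diagonalOf d p) i j = a i j * p := by
  simp [CStarMatrix.mul_apply, diagonalOf_apply]

theorem star_diagonalOf (p : X) : star (diagonalOf d p) = diagonalOf d (star p) := by
  ext i j
  simp only [CStarMatrix.star_apply, diagonalOf_apply, eq_comm (a := j)]
  split_ifs <;> simp

theorem diagonalOf_eq_zero_iff (hd : 0 < d) {p : X} : diagonalOf d p = 0 ↔ p = 0 := by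
  constructor
  · intro h
    simpa [diagonalOf_apply] using congrFun₂ h (⟨0, hd⟩ : Fin d) ⟨0, hd⟩
  · rintro rfl
    ext i j
    simp [diagonalOf_apply]

theorem exists_apply_ne_zero {a : CStarMatrix (Fin d) (Fin d) X} (ha : a ≠ 0) :
    ∃ i j, a i j ≠ 0 := by
  by_contra! h
  exact ha (CStarMatrix.ext h)

/-- The algebra `M_d(B)` of matrices with entries in `B`. -/
def matrixSubalgebra (d : ℕ) (B : NonUnitalStarSubalgebra ℂ X) :
    NonUnitalStarSubalgebra ℂ (CStarMatrix (Fin d) (Fin d) X) where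
  carrier := {a | ∀ i j, a i j ∈ B}
  add_mem' ha hb i j := add_mem (ha i j) (hb i j)
  zero_mem' _ _ := zero_mem B
  mul_mem' ha hb i j := by
    rw [CStarMatrix.mul_apply]
    exact sum_mem fun k _ => mul_mem (ha i k) (hb k j)
  smul_mem' c _ ha i j := SMulMemClass.smul_mem c (ha i j)
  star_mem' ha i j := star_mem (ha j i)

theorem mem_matrixSubalgebra {a : CStarMatrix (Fin d) (Fin d) X} :
    a ∈ matrixSubalgebra d B ↔ ∀ i j, a i j ∈ B := Iff.rfl

theorem diagonalOf_mem_matrixSubalgebra {p : X} (hp : p ∈ B) :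
    diagonalOf d p ∈ matrixSubalgebra d B := fun i j => by
  rw [diagonalOf_apply]
  split_ifs
  exacts [hp, zero_mem B]

variable [PartialOrder X] [StarOrderedRing X]

theorem isFPrime_matrixSubalgebra_iff (hd : 0 < d) :
    IsFPrime (matrixSubalgebra d B) ↔ IsFPrime B := by
  rw [isFPrime_iff, isFPrime_iff]
  constructor
  · intro h p hp q hq hpq
    refine (h _ (diagonalOf_mem_matrixSubalgebra hp) _ (diagonalOf_mem_matrixSubalgebra hq)
      fun Z hZ => ?_).imp (diagonalOf_eq_zero_iff hd).1 (diagonalOf_eq_zero_iff hd).1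
    ext i j
    rw [mul_diagonalOf_apply, diagonalOf_mul_apply, hpq _ (hZ i j), CStarMatrix.zero_apply]
  · intro h a ha b hb hab
    by_contra! h0
    obtain ⟨i, k, hik⟩ := exists_apply_ne_zero h0.1
    obtain ⟨l, j, hlj⟩ := exists_apply_ne_zero h0.2
    refine (h _ (ha i k) _ (hb l j) fun z hz => ?_).elim hik hlj
    have hZ : CStarMatrix.ofMatrix (Matrix.single k l z) ∈ matrixSubalgebra d B := fun m n => by
      rw [CStarMatrix.ofMatrix_apply, Matrix.single_apply]
      split_ifs
      exacts [hz, zero_mem B]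
    simpa [CStarMatrix.mul_apply, Matrix.single_apply, ite_and, Finset.sum_mul] using
      congrFun₂ (hab _ hZ) i j

end MatrixPrimeness

/-! ### Hereditary subalgebras -/

section Hereditary

variable {X : Type*} [NonUnitalCStarAlgebra X]

theorem four_smul_star_mul_mul (a x b : X) :
    (4 : ℂ) • (star a * x * b) =
      star (b + a) * x * (b + a) - star (b - a) * x * (b - a)
        + Complex.I • (star (b + Complex.I • a) * x * (b + Complex.I • a))
        - Complex.I • (star (b - Complex.I • a) * x * (b - Complex.I • a)) := by
  simp only [star_add, star_sub, star_smul, add_mul, mul_add, sub_mul, mul_sub, smul_mul_assoc,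
    mul_smul_comm, smul_add, smul_sub, smul_smul, Complex.star_def, Complex.conj_I]
  match_scalars <;> ring_nf <;> simp only [Complex.I_sq] <;> norm_num

variable [PartialOrder X] [StarOrderedRing X]

theorem mul_eq_zero_of_nonneg_of_le {s x y : X} (hx : 0 ≤ x) (hxy : x ≤ y) (h : s * y = 0) :
    s * x = 0 := by
  obtain ⟨t, rfl⟩ := CStarAlgebra.nonneg_iff_eq_mul_star_self.1 hx
  have hst : s * t * star (s * t) ≤ 0 := calc
    s * t * star (s * t) = s * (t * star t) * star s := by simp only [star_mul, mul_assoc]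
    _ ≤ s * y * star s := star_right_conjugate_le_conjugate hxy s
    _ = 0 := by rw [h, zero_mul]
  rw [mul_mul_star_self_eq_zero_iff]
  exact (CStarRing.mul_star_self_eq_zero_iff _).1 (hst.antisymm (mul_star_self_nonneg _))

variable {Y : NonUnitalStarSubalgebra ℂ X} (hY : ∀ x y : X, 0 ≤ x → x ≤ y → y ∈ Y → x ∈ Y)
include hY

theorem star_mul_mul_self_mem_of_hereditary {a x : X} (ha : a ∈ Y) (hx : 0 ≤ x) :
    star a * x * a ∈ Y := by
  refine hY _ ((‖x‖ : ℂ) • (star a * a)) (star_left_conjugate_nonneg hx a) ?_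
    (SMulMemClass.smul_mem _ (mul_mem (star_mem ha) ha))
  rw [Complex.coe_smul]
  exact CStarAlgebra.star_left_conjugate_le_norm_smul (hb := .of_nonneg hx)

theorem mul_mul_mem_of_hereditary {a b : X} (ha : a ∈ Y) (hb : b ∈ Y) (x : X) :
    a * x * b ∈ Y := by
  have hx : x ∈ Submodule.span ℂ {x : X | 0 ≤ x} := by
    rw [CStarAlgebra.span_nonneg]
    trivial
  induction hx using Submodule.span_induction with
  | mem x hx =>
    have ha' : star a ∈ Y := star_mem ha
    have hself : ∀ {c}, c ∈ Y → star c * x * c ∈ Y :=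
      fun hc => star_mul_mul_self_mem_of_hereditary hY hc hx
    have hIa : Complex.I • star a ∈ Y := SMulMemClass.smul_mem _ ha'
    have key := four_smul_star_mul_mul (star a) x b
    rw [star_star] at key
    rw [← inv_smul_smul₀ (by norm_num : (4 : ℂ) ≠ 0) (a * x * b), key]
    refine SMulMemClass.smul_mem _ (sub_mem (add_mem (sub_mem ?_ ?_) (SMulMemClass.smul_mem _ ?_))
      (SMulMemClass.smul_mem _ ?_))
    exacts [hself (add_mem hb ha'), hself (sub_mem hb ha'), hself (add_mem hb hIa),
      hself (sub_mem hb hIa)]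
  | zero => rw [mul_zero, zero_mul]; exact zero_mem Y
  | add x z _ _ hx hz => rw [mul_add, add_mul]; exact add_mem hx hz
  | smul c x _ hx => rw [mul_smul_comm, smul_mul_assoc]; exact SMulMemClass.smul_mem c hx

end Hereditary

section HereditaryAnnihilator

variable {X : Type*} [NonUnitalCStarAlgebra X] {S : Set X}

/-- The hereditary subalgebra `{y : S y = S y* = 0}`. -/
def hereditaryAnnihilator (S : Set X) : NonUnitalStarSubalgebra ℂ X where
  carrier := {y | y ∈ rightAnnihilator S ∧ star y ∈ rightAnnihilator S}
  add_mem' hx hy := ⟨add_mem hx.1 hy.1, by rw [star_add]; exact add_mem hx.2 hy.2⟩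
  zero_mem' := ⟨zero_mem _, by rw [star_zero]; exact zero_mem _⟩
  mul_mem' hx hy := ⟨fun s hs => by rw [← mul_assoc, hx.1 s hs, zero_mul],
    fun s hs => by rw [star_mul, ← mul_assoc, hy.2 s hs, zero_mul]⟩
  smul_mem' c x hx := ⟨Submodule.smul_mem _ c hx.1, by
    rw [star_smul]; exact Submodule.smul_mem _ _ hx.2⟩
  star_mem' hx := ⟨hx.2, by rw [star_star]; exact hx.1⟩

theorem mem_hereditaryAnnihilator_of_nonneg_of_le [PartialOrder X] [StarOrderedRing X] {x y : X}
    (hx : 0 ≤ x) (hxy : x ≤ y) (hy : y ∈ hereditaryAnnihilator S) :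
    x ∈ hereditaryAnnihilator S := by
  have hxS : x ∈ rightAnnihilator S := fun s hs => mul_eq_zero_of_nonneg_of_le hx hxy (hy.1 s hs)
  exact ⟨hxS, by rwa [(IsSelfAdjoint.of_nonneg hx).star_eq]⟩

end HereditaryAnnihilator

/-! ### Fixed points, fixed point algebras and the spaces `Y₂(π)` -/

section FixedPoints

variable {X : Type*} [NonUnitalCStarAlgebra X] {G : Type*} [Group G]

/-- The fixed point algebra `X^α`. -/
def fixedPoints (α : G →* (X ≃⋆ₐ[ℂ] X)) : NonUnitalStarSubalgebra ℂ X where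
  carrier := {x | ∀ g, α g x = x}
  add_mem' hx hy g := by rw [map_add, hx g, hy g]
  zero_mem' g := map_zero (α g)
  mul_mem' hx hy g := by rw [map_mul, hx g, hy g]
  smul_mem' c x hx g := by rw [map_smul, hx g]
  star_mem' hx g := by rw [map_star, hx g]

end FixedPoints

section SpectralAlgebra

variable {X : Type*} [NonUnitalCStarAlgebra X] {d : ℕ}

theorem rmulScalar_rmulScalar (a : CStarMatrix (Fin d) (Fin d) X)
    (U V : Matrix (Fin d) (Fin d) ℂ) :
    rmulScalar (rmulScalar a U) V = rmulScalar a (U * V) := by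
  ext i j
  simp only [rmulScalar_apply, Matrix.mul_apply, Finset.smul_sum, Finset.sum_smul, smul_smul]
  rw [Finset.sum_comm]
  simp only [mul_comm]

theorem rmulScalar_one (a : CStarMatrix (Fin d) (Fin d) X) : rmulScalar a 1 = a := by
  ext i j
  simp [Matrix.one_apply, ite_smul]

theorem lmulScalar_diagonalOf (U : Matrix (Fin d) (Fin d) ℂ) (p : X) :
    lmulScalar U (diagonalOf d p) = rmulScalar (diagonalOf d p) U := by
  ext i j
  simp [diagonalOf_apply]

variable {G : Type*} [Group G] {α : G →* (X ≃⋆ₐ[ℂ] X)}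

theorem mem_matrixSubalgebra_fixedPoints_iff {a : CStarMatrix (Fin d) (Fin d) X} :
    a ∈ matrixSubalgebra d (fixedPoints α) ↔ ∀ g, entrywise (α g) a = a :=
  ⟨fun h g => CStarMatrix.ext fun i j => h i j g, fun h i j g => congrFun₂ (h g) i j⟩

variable [TopologicalSpace G] {π : IrrepMatrix G} {Y : NonUnitalStarSubalgebra ℂ X}
  {a b : CStarMatrix (Fin π.dim) (Fin π.dim) X}

theorem IrrepMatrix.mat_mul_star (π : IrrepMatrix G) (g : G) : π.mat g * star (π.mat g) = 1 :=
  Unitary.mul_star_self_of_mem (π.toHom g).2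

theorem mem_fixedAlgebra_iff :
    a ∈ fixedAlgebra α π Y ↔ (∀ i j, a i j ∈ Y) ∧
      ∀ g, entrywise (α g) a = lmulScalar (star (π.mat g)) (rmulScalar a (π.mat g)) := by
  refine and_congr_right fun _ => forall_congr' fun g => ?_
  rw [adAction]
  constructor
  · intro h
    conv_rhs => rw [← h]
    rw [← lmulScalar_rmulScalar, lmulScalar_lmulScalar, rmulScalar_rmulScalar, π.mat_star_mul,
      rmulScalar_one, lmulScalar_one]
  · intro h
    rw [h, ← lmulScalar_rmulScalar, rmulScalar_rmulScalar, lmulScalar_lmulScalar, π.mat_mul_star,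
      rmulScalar_one, lmulScalar_one]

theorem fixedAlgebra_top_eq_matrixSubalgebra (hπ : ∀ g, π.mat g = 1) :
    fixedAlgebra α π ⊤ = matrixSubalgebra π.dim (fixedPoints α) := by
  ext a
  simp only [mem_fixedAlgebra_iff, mem_matrixSubalgebra_fixedPoints_iff, hπ, star_one,
    rmulScalar_one, lmulScalar_one, NonUnitalStarAlgebra.mem_top, implies_true, true_and]

theorem fixedAlgebra_le_top : fixedAlgebra α π Y ≤ fixedAlgebra α π ⊤ :=
  fun _ ha => ⟨fun _ _ => trivial, ha.2⟩

theorem spectralSubspaceTwo_subset_top :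
    spectralSubspaceTwo α π Y ⊆ spectralSubspaceTwo α π ⊤ :=
  fun _ ha => ⟨fun _ _ => trivial, ha.2⟩

theorem diagonalOf_mem_fixedAlgebra {p : X} (hp : p ∈ fixedPoints α) (hpY : p ∈ Y) :
    diagonalOf π.dim p ∈ fixedAlgebra α π Y := by
  refine mem_fixedAlgebra_iff.2 ⟨diagonalOf_mem_matrixSubalgebra hpY, fun g => ?_⟩
  rw [mem_matrixSubalgebra_fixedPoints_iff.1 (diagonalOf_mem_matrixSubalgebra hp),
    ← lmulScalar_diagonalOf, lmulScalar_lmulScalar, π.mat_star_mul, lmulScalar_one]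

theorem star_mul_mem_fixedAlgebra (ha : a ∈ spectralSubspaceTwo α π Y)
    (hb : b ∈ spectralSubspaceTwo α π Y) : star a * b ∈ fixedAlgebra α π Y := by
  refine mem_fixedAlgebra_iff.2
    ⟨mul_mem (star_mem (mem_matrixSubalgebra.2 ha.1)) (mem_matrixSubalgebra.2 hb.1), fun g => ?_⟩
  rw [entrywise_mul, entrywise_star, ha.2 g, hb.2 g, star_rmulScalar, rmulScalar_mul,
    lmulScalar_mul]

theorem mul_star_mem_matrixSubalgebra_fixedPoints (ha : a ∈ spectralSubspaceTwo α π ⊤)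
    (hb : b ∈ spectralSubspaceTwo α π ⊤) :
    a * star b ∈ matrixSubalgebra π.dim (fixedPoints α) :=
  mem_matrixSubalgebra_fixedPoints_iff.2 fun g => by
    rw [entrywise_mul, entrywise_star, ha.2 g, hb.2 g, star_rmulScalar, rmulScalar_mul_eq,
      lmulScalar_lmulScalar, π.mat_mul_star, lmulScalar_one]

theorem mul_mem_spectralSubspaceTwo (ha : a ∈ spectralSubspaceTwo α π Y)
    (hb : b ∈ fixedAlgebra α π Y) : a * b ∈ spectralSubspaceTwo α π Y := by
  have hb' := mem_fixedAlgebra_iff.1 hb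
  refine ⟨mul_mem (mem_matrixSubalgebra.2 ha.1) (mem_matrixSubalgebra.2 hb'.1), fun g => ?_⟩
  rw [entrywise_mul, ha.2 g, hb'.2 g, rmulScalar_mul_eq,
    lmulScalar_lmulScalar, π.mat_mul_star, lmulScalar_one, rmulScalar_mul]

theorem fixedPoints_mul_mem_spectralSubspaceTwo
    (hb : b ∈ matrixSubalgebra π.dim (fixedPoints α)) (ha : a ∈ spectralSubspaceTwo α π ⊤) :
    b * a ∈ spectralSubspaceTwo α π ⊤ :=
  ⟨fun _ _ => trivial, fun g => by
    rw [entrywise_mul, mem_matrixSubalgebra_fixedPoints_iff.1 hb g, ha.2, rmulScalar_mul]⟩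

end SpectralAlgebra

/-! ### Irreducible representations -/

section IrrepMatrix

variable {G : Type*} [Group G]

/-- The representation of `G` on `ℂⁿ` by unitary matrices `τ g`. -/
def matrixRepresentation {n : ℕ} (τ : G →* Matrix.unitaryGroup (Fin n) ℂ) :
    Representation ℂ G (Fin n → ℂ) :=
  (Matrix.toLinAlgEquiv' (R := ℂ) (n := Fin n) : _ →* _).comp
    ((Matrix.unitaryGroup (Fin n) ℂ).subtype.comp τ)

theorem matrixRepresentation_apply {n : ℕ} (τ : G →* Matrix.unitaryGroup (Fin n) ℂ) (g : G)
    (v : Fin n → ℂ) :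
    matrixRepresentation τ g v = (τ g : Matrix (Fin n) (Fin n) ℂ).mulVec v := rfl

variable [TopologicalSpace G]

theorem IrrepMatrix.mat_mul (π : IrrepMatrix G) (g h : G) :
    π.mat (g * h) = π.mat g * π.mat h := by
  simp [IrrepMatrix.mat]

theorem IrrepMatrix.mat_inv (π : IrrepMatrix G) (g : G) : π.mat g⁻¹ = star (π.mat g) := by
  simp [IrrepMatrix.mat]

theorem IrrepMatrix.mat_inv_apply (π : IrrepMatrix G) (g : G) (i j : Fin π.dim) :
    π.mat g⁻¹ i j = star (π.mat g j i) := by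
  rw [π.mat_inv, Matrix.star_apply]

theorem IrrepMatrix.continuous_mat_apply (π : IrrepMatrix G) (i j : Fin π.dim) :
    Continuous fun g => π.mat g i j :=
  (continuous_subtype_val.comp π.continuous_toHom).matrix_elem i j

theorem IrrepMatrix.continuous_star_mat_apply (π : IrrepMatrix G) (i j : Fin π.dim) :
    Continuous fun g => star (π.mat g i j) :=
  continuous_star.comp (π.continuous_mat_apply i j)

theorem IrrepMatrix.dim_pos (π : IrrepMatrix G) : 0 < π.dim := by
  rw [Nat.pos_iff_ne_zero]
  intro h
  refine π.irreducible.toNontrivial.exists_pair_ne.elim fun S hS => hS.elim fun T hST => hST ?_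
  apply Subrepresentation.toSubmodule_injective
  have : IsEmpty (Fin π.dim) := by rw [h]; infer_instance
  exact Subsingleton.elim _ _

theorem IrrepMatrix.exists_eq_smul_one_of_commute (π : IrrepMatrix G)
    (A : Matrix (Fin π.dim) (Fin π.dim) ℂ) (hA : ∀ g, A * π.mat g = π.mat g * A) :
    ∃ c : ℂ, A = c • (1 : Matrix (Fin π.dim) (Fin π.dim) ℂ) := by
  have : (matrixRepresentation π.toHom).IsIrreducible := π.irreducible
  let T : (matrixRepresentation π.toHom).IntertwiningMap (matrixRepresentation π.toHom) :=
    LinearMap.intertwiningMap_of_isIntertwiningMap _ _ (Matrix.toLin' A) fun g v => by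
      simp only [matrixRepresentation_apply, Matrix.toLin'_apply, Matrix.mulVec_mulVec]
      exact congrArg (Matrix.mulVec · v) (hA g)
  obtain ⟨c, hc⟩ :=
    Representation.IsIrreducible.algebraMap_intertwiningMap_bijective_of_isAlgClosed.2 T
  have hAc : Matrix.toLin' A = c • LinearMap.id :=
    (congrArg Representation.IntertwiningMap.toLinearMap hc).symm
  exact ⟨c, Matrix.toLin'.injective (by rw [hAc, map_smul, Matrix.toLin'_one])⟩

end IrrepMatrix

section Subrepresentations

variable {G V W : Type*} [Group G] [AddCommGroup V] [Module ℂ V] [AddCommGroup W] [Module ℂ W]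
  {ρ : Representation ℂ G V} {σ : Representation ℂ G W}

theorem isIrreducible_of_equiv (Φ : ρ.Equiv σ) (hσ : σ.IsIrreducible) : ρ.IsIrreducible := by
  let comap : Subrepresentation σ ≃o Subrepresentation ρ :=
    { toFun S := ⟨S.toSubmodule.comap Φ.toLinearEquiv.toLinearMap, fun g v hv => by
        rw [Submodule.mem_comap] at hv ⊢
        convert S.apply_mem_toSubmodule g hv using 1
        exact Representation.IntertwiningMap.isIntertwining _ _ Φ.toIntertwiningMap g v⟩
      invFun S := ⟨S.toSubmodule.comap Φ.symm.toLinearEquiv.toLinearMap, fun g v hv => by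
        rw [Submodule.mem_comap] at hv ⊢
        convert S.apply_mem_toSubmodule g hv using 1
        exact Representation.IntertwiningMap.isIntertwining _ _ Φ.symm.toIntertwiningMap g v⟩
      left_inv S := SetLike.ext fun w => by
        change Φ.toLinearEquiv (Φ.toLinearEquiv.symm w) ∈ S ↔ w ∈ S
        rw [LinearEquiv.apply_symm_apply]
      right_inv S := SetLike.ext fun v => by
        change Φ.toLinearEquiv.symm (Φ.toLinearEquiv v) ∈ S ↔ v ∈ S
        rw [LinearEquiv.symm_apply_apply]
      map_rel_iff' :=
        Submodule.comap_le_comap_iff_of_surjective Φ.toLinearEquiv.surjective }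
  exact comap.isSimpleOrder_iff.1 hσ

theorem isIrreducible_toRepresentation {S : Subrepresentation ρ} (hS : IsAtom S) :
    S.toRepresentation.IsIrreducible := by
  have hsub : Function.Injective S.toSubmodule.subtype := Subtype.val_injective
  refine @IsSimpleOrder.mk _ _ _ ⟨⊥, ⊤, fun h => hS.1 ?_⟩ fun T => ?_
  · apply Subrepresentation.toSubmodule_injective
    have h' : (⊥ : Submodule ℂ S.toSubmodule) = ⊤ := congrArg Subrepresentation.toSubmodule h
    exact Submodule.subsingleton_iff_eq_bot.1
      ((Submodule.subsingleton_iff ℂ).1 (subsingleton_of_bot_eq_top h'))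
  · let image : Subrepresentation ρ := ⟨T.toSubmodule.map S.toSubmodule.subtype, by
      rintro g _ ⟨v, hv, rfl⟩
      exact ⟨_, T.apply_mem_toSubmodule g hv, rfl⟩⟩
    have himage : image ≤ S := Submodule.map_subtype_le _ _
    refine (hS.le_iff.1 himage).imp (fun h => ?_) fun h => ?_ <;>
      refine Subrepresentation.toSubmodule_injective (Submodule.map_injective_of_injective hsub
        ((congrArg Subrepresentation.toSubmodule h).trans ?_))
    · exact (Submodule.map_bot _).symm
    · exact (Submodule.map_subtype_top _).symm

theorem exists_isIrreducible_subrepresentation [FiniteDimensional ℂ V] [Nontrivial V]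
    (ρ : Representation ℂ G V) :
    ∃ S : Subrepresentation ρ, S.toRepresentation.IsIrreducible := by
  have hmono : StrictMono (Subrepresentation.toSubmodule (ρ := ρ)) :=
    Monotone.strictMono_of_injective (fun _ _ h => h) Subrepresentation.toSubmodule_injective
  have := hmono.wellFoundedLT
  have := isAtomic_of_orderBot_wellFounded_lt (α := Subrepresentation ρ) wellFounded_lt
  have : Nontrivial (Subrepresentation ρ) :=
    ⟨⊥, ⊤, fun h => bot_ne_top (congrArg Subrepresentation.toSubmodule h)⟩
  obtain h | ⟨S, hS, -⟩ := IsAtomic.eq_bot_or_exists_atom_le (⊤ : Subrepresentation ρ)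
  · exact absurd h top_ne_bot
  · exact ⟨S, isIrreducible_toRepresentation hS⟩

end Subrepresentations

section UnitaryRepresentations

variable {G : Type*} [Group G] [TopologicalSpace G] {V : Type*}

/-- The family `e` transforms under the operators `ρ g` according to the matrix representation
`π`: it spans a quotient of `π`. -/
def TransformsBy [AddCommMonoid V] [Module ℂ V] (ρ : G → V → V) (π : IrrepMatrix G)
    (e : Fin π.dim → V) : Prop :=
  ∀ g i, ρ g (e i) = ∑ j, π.mat g j i • e j

theorem sum_smul_sum_smul [AddCommMonoid V] [Module ℂ V] {m n : Type*} [Fintype m] [Fintype n]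
    (U : Matrix n m ℂ) (c : m → ℂ) (e : n → V) :
    ∑ i, c i • ∑ j, U j i • e j = ∑ j, U.mulVec c j • e j := by
  simp only [Matrix.mulVec, dotProduct, Finset.sum_smul, Finset.smul_sum, smul_smul]
  rw [Finset.sum_comm]
  simp only [mul_comm]

theorem exists_transformsBy_of_unitarilyEquivalent [AddCommGroup V] [Module ℂ V]
    {ρ : Representation ℂ G V} {π π' : IrrepMatrix G} (h : UnitarilyEquivalent π' π)
    {e : Fin π.dim → V} (hindep : LinearIndependent ℂ e)
    (he : TransformsBy (fun g => ρ g) π e) :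
    ∃ e' : Fin π'.dim → V, LinearIndependent ℂ e' ∧ TransformsBy (fun g => ρ g) π' e' := by
  obtain ⟨U, hU, -, hUπ⟩ := h
  refine ⟨fun i => ∑ j, U j i • e j, ?_, fun g i => ?_⟩
  · rw [Fintype.linearIndependent_iff] at hindep ⊢
    intro c hc
    rw [sum_smul_sum_smul] at hc
    have hUc : U.mulVec c = 0 := funext (hindep _ hc)
    refine congrFun (?_ : c = 0)
    rw [← Matrix.one_mulVec c, ← hU, ← Matrix.mulVec_mulVec, hUc, Matrix.mulVec_zero]
  · calc ρ g (∑ j, U j i • e j) = ∑ j, U j i • ∑ k, π.mat g k j • e k := by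
          simp only [map_sum, map_smul, he g _]
      _ = ∑ k, (π.mat g * U) k i • e k := sum_smul_sum_smul _ _ _
      _ = ∑ k, (U * π'.mat g) k i • e k := by rw [hUπ]
      _ = ∑ j, π'.mat g j i • ∑ k, U k j • e k := (sum_smul_sum_smul _ _ _).symm

variable [NormedAddCommGroup V] [InnerProductSpace ℂ V] [FiniteDimensional ℂ V]
  {ρ : Representation ℂ G V}

theorem exists_orthonormalBasis_transformsBy (hirr : ρ.IsIrreducible)
    (hinner : ∀ g u v, inner ℂ (ρ g u) (ρ g v) = inner ℂ u v)
    (hcont : ∀ u, Continuous fun g => ρ g u) :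
    ∃ (π : IrrepMatrix G) (b : OrthonormalBasis (Fin π.dim) ℂ V),
      TransformsBy (fun g => ρ g) π b := by
  let b := stdOrthonormalBasis ℂ V
  have hadj : ∀ g, star (ρ g) * ρ g = 1 := fun g => by
    ext u
    refine ext_inner_right ℂ fun v => ?_
    rw [LinearMap.star_eq_adjoint, Module.End.mul_apply, LinearMap.adjoint_inner_left, hinner]
    rfl
  let τ : G →* Matrix.unitaryGroup (Fin (Module.finrank ℂ V)) ℂ :=
    { toFun g := ⟨LinearMap.toMatrixOrthonormal b (ρ g), Matrix.mem_unitaryGroup_iff'.2 (by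
        rw [← map_star, ← map_mul, hadj, map_one])⟩
      map_one' := Subtype.ext (by simp)
      map_mul' g h := Subtype.ext (by simp only [map_mul]; rfl) }
  have hτ : Continuous τ := by
    refine Continuous.subtype_mk (continuous_matrix fun i j => ?_) _
    simp only [LinearMap.toMatrixOrthonormal_apply_apply]
    exact continuous_const.inner (hcont _)
  have hb : ∀ g i, ρ g (b i) = ∑ j, (τ g : Matrix _ _ ℂ) j i • b j := fun g i => by
    conv_lhs => rw [← b.sum_repr' (ρ g (b i))]
    exact Finset.sum_congr rfl fun j _ => by
      rw [← LinearMap.toMatrixOrthonormal_apply_apply]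
      rfl
  let Φ : (matrixRepresentation τ).Equiv ρ := .mk b.toBasis.equivFun.symm fun g => by
    refine LinearMap.ext fun v => ?_
    simp only [LinearMap.comp_apply, LinearEquiv.coe_coe, Module.Basis.equivFun_symm_apply,
      OrthonormalBasis.coe_toBasis, map_sum, map_smul, hb,
      matrixRepresentation_apply, sum_smul_sum_smul]
  exact ⟨⟨_, τ, hτ, isIrreducible_of_equiv Φ hirr⟩, b, hb⟩

theorem exists_transformsBy [Nontrivial V]
    (hinner : ∀ g u v, inner ℂ (ρ g u) (ρ g v) = inner ℂ u v)
    (hcont : ∀ u, Continuous fun g => ρ g u) :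
    ∃ (π : GroupDual G) (e : Fin π.rep.dim → V), LinearIndependent ℂ e ∧
      TransformsBy (fun g => ρ g) π.rep e := by
  obtain ⟨S, hS⟩ := exists_isIrreducible_subrepresentation ρ
  obtain ⟨π, b, hb⟩ := exists_orthonormalBasis_transformsBy hS
    (fun g u v => hinner g u v) (fun u => (hcont u).subtype_mk _)
  have he : TransformsBy (fun g => ρ g) π fun i => (b i : V) := fun g i =>
    (congrArg Subtype.val (hb g i)).trans (by simp)
  have hindep : LinearIndependent ℂ fun i => (b i : V) :=
    b.toBasis.linearIndependent.map' S.toSubmodule.subtype (Submodule.ker_subtype _)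
  exact ⟨Quotient.mk _ π, exists_transformsBy_of_unitarilyEquivalent
    (Quotient.mk_out (s := irrepSetoid G) π) hindep he⟩

theorem exists_rep_mat_eq_one (G : Type*) [Group G] [TopologicalSpace G] :
    ∃ π : GroupDual G, ∀ g, π.rep.mat g = 1 := by
  obtain ⟨π, e, hindep, he⟩ := exists_transformsBy (ρ := Representation.trivial ℂ G ℂ)
    (fun _ _ _ => rfl) fun _ => continuous_const
  refine ⟨π, fun g => Matrix.ext fun j i => ?_⟩
  have h0 : ∑ j, (π.rep.mat g j i -
      (1 : Matrix (Fin π.rep.dim) (Fin π.rep.dim) ℂ) j i) • e j = 0 := by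
    simp only [sub_smul, Finset.sum_sub_distrib, ← he g i, Matrix.one_apply, ite_smul, one_smul,
      zero_smul, Finset.sum_ite_eq', Finset.mem_univ, if_true]
    exact sub_self _
  exact sub_eq_zero.1 (Fintype.linearIndependent_iff.1 hindep _ h0 j)

end UnitaryRepresentations

/-! ### Orthogonality relations and completeness of matrix coefficients -/

section CompactOperators

/-- The integral operator `u ↦ (x ↦ ⟪k x, u⟫)` of a continuous family `k` of vectors. -/
def innerKernelOperator {K H : Type*} [TopologicalSpace K] [CompactSpace K]
    [NormedAddCommGroup H] [InnerProductSpace ℂ H] (k : C(K, H)) : H →L[ℂ] C(K, ℂ) :=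
  LinearMap.mkContinuous
    { toFun := fun u => ⟨fun x => inner ℂ (k x) u, k.continuous.inner continuous_const⟩
      map_add' := fun u v => by ext x; simp
      map_smul' := fun c u => by ext x; simp } ‖k‖ (fun u => by
    rw [ContinuousMap.norm_le _ (by positivity)]
    intro x
    exact (norm_inner_le_norm _ _).trans
      (mul_le_mul_of_nonneg_right (k.norm_coe_le_norm x) (norm_nonneg u)))

theorem isCompactOperator_innerKernelOperator {K H : Type*} [TopologicalSpace K] [CompactSpace K]
    [NormedAddCommGroup H] [InnerProductSpace ℂ H] (k : C(K, H)) :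
    IsCompactOperator (innerKernelOperator k) := by
  let ι := ContinuousMap.linearIsometryBoundedOfCompact K ℂ ℂ
  let j : C(K, ℂ) →L[ℂ] BoundedContinuousFunction K ℂ :=
    ι.toContinuousLinearEquiv.toContinuousLinearMap
  let j' : BoundedContinuousFunction K ℂ →L[ℂ] C(K, ℂ) :=
    ι.symm.toContinuousLinearEquiv.toContinuousLinearMap
  suffices h : IsCompactOperator (j ∘L innerKernelOperator k) from h.clm_comp j'
  refine (isCompactOperator_iff_isCompact_closure_image_closedBall
    (j ∘L innerKernelOperator k : H →ₗ[ℂ] BoundedContinuousFunction K ℂ) zero_lt_one).2 ?_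
  refine BoundedContinuousFunction.arzela_ascoli (Metric.closedBall (0 : ℂ) ‖k‖)
    (isCompact_closedBall _ _) _ ?_ ?_
  · rintro _ x ⟨u, hu, rfl⟩
    rw [mem_closedBall_zero_iff] at hu ⊢
    calc ‖inner ℂ (k x) u‖ ≤ ‖k x‖ * ‖u‖ := norm_inner_le_norm _ _
      _ ≤ ‖k‖ * 1 := by gcongr; exact k.norm_coe_le_norm x
      _ = ‖k‖ := mul_one _
  · intro x₀
    rw [Metric.equicontinuousAt_iff_right]
    intro ε hε
    filter_upwards [Metric.continuousAt_iff'.1 (k.continuous.continuousAt (x := x₀)) ε hε]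
      with x hx
    rintro ⟨_, u, hu, rfl⟩
    rw [mem_closedBall_zero_iff] at hu
    change dist (inner ℂ (k x₀) u) (inner ℂ (k x) u) < ε
    rw [dist_comm, dist_eq_norm, ← inner_sub_left]
    calc ‖inner ℂ (k x - k x₀) u‖ ≤ ‖k x - k x₀‖ * ‖u‖ := norm_inner_le_norm _ _
      _ ≤ ‖k x - k x₀‖ * 1 := by gcongr
      _ < ε := by rwa [mul_one, ← dist_eq_norm]

end CompactOperators

section HarmonicAnalysis

variable {G : Type*} [Group G] [TopologicalSpace G] [IsTopologicalGroup G] [CompactSpace G]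
  [MeasurableSpace G] [BorelSpace G]

variable (G) in
/-- The normalized Haar measure of a compact group. -/
abbrev normalizedHaar : Measure G :=
  MeasureTheory.Measure.haarMeasure (⊤ : TopologicalSpace.PositiveCompacts G)

instance : IsProbabilityMeasure (normalizedHaar G) :=
  ⟨by simpa using Measure.haarMeasure_self (K₀ := (⊤ : TopologicalSpace.PositiveCompacts G))⟩

theorem integrable_normalizedHaar {E : Type*} [NormedAddCommGroup E] {f : G → E}
    (hf : Continuous f) : Integrable f (normalizedHaar G) :=
  hf.integrable_of_hasCompactSupport (HasCompactSupport.of_compactSpace f)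

theorem IrrepMatrix.exists_integral_mat_mul_star_mat_eq (π : IrrepMatrix G) (k l : Fin π.dim) :
    ∃ c : ℂ, ∀ i j, ∫ g, π.mat g i k * star (π.mat g j l) ∂(normalizedHaar G) =
      if i = j then c else 0 := by
  let A : Matrix (Fin π.dim) (Fin π.dim) ℂ :=
    Matrix.of fun i j => ∫ g, π.mat g i k * star (π.mat g j l) ∂(normalizedHaar G)
  have hA : ∀ h, A = π.mat h * A * star (π.mat h) := by
    intro h
    ext a b
    simp only [Matrix.mul_apply, A, Matrix.of_apply, Matrix.star_apply]
    conv_lhs => rw [← integral_mul_left_eq_self _ h]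
    have hint : ∀ c e, Integrable (fun g => π.mat h a e * π.mat g e k *
        (star (π.mat h b c) * star (π.mat g c l))) (normalizedHaar G) := fun c e =>
      integrable_normalizedHaar ((continuous_const.mul (π.continuous_mat_apply e k)).mul
        (continuous_const.mul (π.continuous_star_mat_apply c l)))
    simp only [π.mat_mul, Matrix.mul_apply, star_sum, star_mul', Finset.sum_mul, Finset.mul_sum]
    rw [integral_finsetSum _ fun c _ => integrable_finsetSum _ fun e _ => hint c e]
    refine Finset.sum_congr rfl fun c _ => ?_
    rw [integral_finsetSum _ fun e _ => hint c e]
    refine Finset.sum_congr rfl fun e _ => ?_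
    rw [← integral_const_mul, ← integral_mul_const]
    congr with g
    ring
  obtain ⟨c, hc⟩ := π.exists_eq_smul_one_of_commute A fun h => by
    conv_lhs => rw [hA h]
    rw [Matrix.mul_assoc, π.mat_star_mul, Matrix.mul_one]
  exact ⟨c, fun i j => (congrFun₂ hc i j).trans (by simp [Matrix.one_apply])⟩

theorem IrrepMatrix.integral_mat_mul_star_mat (π : IrrepMatrix G) (i j k l : Fin π.dim) :
    (π.dim : ℂ) * ∫ g, π.mat g i k * star (π.mat g j l) ∂(normalizedHaar G) =
      if i = j ∧ k = l then 1 else 0 := by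
  obtain ⟨c, hc⟩ := π.exists_integral_mat_mul_star_mat_eq k l
  have hcol : ∀ g, ∑ a, π.mat g a k * star (π.mat g a l) = if k = l then 1 else 0 := fun g => by
    have := congrFun₂ (π.mat_star_mul g) l k
    simp only [Matrix.mul_apply, Matrix.star_apply, Matrix.one_apply] at this
    simp only [mul_comm (π.mat g _ k), this, eq_comm]
  have hdc : (π.dim : ℂ) * c = if k = l then 1 else 0 := calc
    (π.dim : ℂ) * c = ∑ a, ∫ g, π.mat g a k * star (π.mat g a l) ∂(normalizedHaar G) := by
      simp only [hc, ↓reduceIte, Finset.sum_const, Finset.card_univ, Fintype.card_fin,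
        nsmul_eq_mul]
    _ = ∫ g, ∑ a, π.mat g a k * star (π.mat g a l) ∂(normalizedHaar G) :=
      (integral_finsetSum _ fun a _ => integrable_normalizedHaar
        ((π.continuous_mat_apply a k).mul (π.continuous_star_mat_apply a l))).symm
    _ = if k = l then 1 else 0 := by
      simp only [hcol, integral_const, probReal_univ, one_smul]
  rw [hc, mul_ite, mul_zero, hdc, ite_and]

end HarmonicAnalysis

section PeterWeyl

theorem apply_adjoint_of_commute {G H : Type*} [Group G] [NormedAddCommGroup H]
    [InnerProductSpace ℂ H] [CompleteSpace H] {ρ : Representation ℂ G H}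
    (hinner : ∀ g u v, inner ℂ (ρ g u) (ρ g v) = inner ℂ u v) {A : H →L[ℂ] H}
    (hA : ∀ g u, A (ρ g u) = ρ g (A u)) (g : G) (u : H) :
    ContinuousLinearMap.adjoint A (ρ g u) = ρ g (ContinuousLinearMap.adjoint A u) := by
  refine ext_inner_right ℂ fun v => ?_
  have hv : v = ρ g (ρ g⁻¹ v) := (ρ.self_inv_apply g v).symm
  rw [hv, hinner, ContinuousLinearMap.adjoint_inner_left, ContinuousLinearMap.adjoint_inner_left,
    hA, hinner]

theorem eq_zero_of_forall_transformsBy {G H : Type*} [Group G] [TopologicalSpace G]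
    [NormedAddCommGroup H] [InnerProductSpace ℂ H] [CompleteSpace H] {ρ : Representation ℂ G H}
    (hinner : ∀ g u v, inner ℂ (ρ g u) (ρ g v) = inner ℂ u v)
    (hcont : ∀ u, Continuous fun g => ρ g u) {T : H →L[ℂ] H} (hcomp : IsCompactOperator T)
    (hsymm : (T : H →ₗ[ℂ] H).IsSymmetric) (hcomm : ∀ g u, T (ρ g u) = ρ g (T u))
    (h : ∀ (π : GroupDual G) (e : Fin π.rep.dim → H), TransformsBy (fun g => ρ g) π.rep e →
      ∀ i, T (e i) = 0) : T = 0 := by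
  rw [← ContinuousLinearMap.eq_zero_of_forall_hasEigenvalue_eq_zero hcomp hsymm]
  intro c hc
  by_contra hc0
  have := ContinuousLinearMap.finite_dimensional_eigenspace hcomp c hc0
  let E : Subrepresentation ρ := ⟨Module.End.eigenspace (T : H →ₗ[ℂ] H) c, fun g u hu => by
    rw [Module.End.mem_eigenspace_iff] at hu ⊢
    change T (ρ g u) = _
    rw [hcomm, ← map_smul, ← hu]
    rfl⟩
  have : FiniteDimensional ℂ E.toSubmodule := this
  have : Nontrivial E.toSubmodule := Submodule.nontrivial_iff_ne_bot.2 hc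
  obtain ⟨π, e, hindep, he⟩ := exists_transformsBy (ρ := E.toRepresentation)
    (fun g u v => hinner g u v) fun u => (hcont u).subtype_mk _
  have heE : ∀ i, T (e i) = c • (e i : H) := fun i => Module.End.mem_eigenspace_iff.1 (e i).2
  have hTe := h π (fun i => e i) fun g i => (congrArg Subtype.val (he g i)).trans (by simp)
  let i : Fin π.rep.dim := ⟨0, π.rep.dim_pos⟩
  refine hindep.ne_zero i (Subtype.ext ((smul_eq_zero.1 ?_).resolve_left hc0))
  rw [← heE, hTe]

variable {G : Type*} [Group G] [TopologicalSpace G] [IsTopologicalGroup G]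

/-- The kernel `(x, y) ↦ conj (f (y⁻¹ x))` of right convolution by `f`, conjugated because inner
products are conjugate-linear in the first variable. -/
def convolutionKernel (f : C(G, ℂ)) : C(G, C(G, ℂ)) :=
  ContinuousMap.curry ⟨fun p : G × G => star (f (p.2⁻¹ * p.1)), by fun_prop⟩

theorem convolutionKernel_apply (f : C(G, ℂ)) (x y : G) :
    convolutionKernel f x y = star (f (y⁻¹ * x)) := rfl

variable [CompactSpace G] [MeasurableSpace G] [BorelSpace G]

variable (G) in
/-- The left regular representation on `L²(G)`. -/
def leftRegular : Representation ℂ G (Lp ℂ 2 (normalizedHaar G)) where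
  toFun g :=
    { toFun := fun u => DomMulAct.mk g⁻¹ • u
      map_add' := fun u v => smul_add _ u v
      map_smul' := fun c u => smul_comm _ c u }
  map_one' := by ext1 u; simp
  map_mul' g h := by
    ext1 u
    simp [mul_smul]

theorem leftRegular_inner (g : G) (u v : Lp ℂ 2 (normalizedHaar G)) :
    inner ℂ (leftRegular G g u) (leftRegular G g v) = inner ℂ u v :=
  LinearIsometry.inner_map_map (⟨leftRegular G g, fun _ => DomMulAct.norm_smul_Lp _ _⟩ :
    Lp ℂ 2 (normalizedHaar G) →ₗᵢ[ℂ] Lp ℂ 2 (normalizedHaar G)) u v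

theorem continuous_leftRegular (u : Lp ℂ 2 (normalizedHaar G)) :
    Continuous fun g => leftRegular G g u := by
  have : Fact ((2 : ENNReal) ≠ ⊤) := ⟨by simp⟩
  exact ((DomMulAct.continuous_mk.comp continuous_inv).smul continuous_const)

theorem leftRegular_toLp (g : G) (c : C(G, ℂ)) :
    leftRegular G g (ContinuousMap.toLp 2 (normalizedHaar G) ℂ c) =
      ContinuousMap.toLp 2 (normalizedHaar G) ℂ (c.comp ⟨fun x => g⁻¹ * x, by fun_prop⟩) :=
  rfl

/-- Right convolution by `f`, as an operator from `L²(G)` to `C(G)`. -/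
def convolutionOperator (f : C(G, ℂ)) : Lp ℂ 2 (normalizedHaar G) →L[ℂ] C(G, ℂ) :=
  innerKernelOperator
    ⟨fun x => ContinuousMap.toLp 2 (normalizedHaar G) ℂ (convolutionKernel f x), by fun_prop⟩

theorem convolutionOperator_apply (f : C(G, ℂ)) (u : Lp ℂ 2 (normalizedHaar G)) (x : G) :
    convolutionOperator f u x =
      inner ℂ (ContinuousMap.toLp 2 (normalizedHaar G) ℂ (convolutionKernel f x)) u := rfl

theorem convolutionOperator_leftRegular (f : C(G, ℂ)) (h : G) (u : Lp ℂ 2 (normalizedHaar G))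
    (x : G) : convolutionOperator f (leftRegular G h u) x = convolutionOperator f u (h⁻¹ * x) := by
  have hk : leftRegular G h (ContinuousMap.toLp 2 (normalizedHaar G) ℂ
      (convolutionKernel f (h⁻¹ * x))) =
        ContinuousMap.toLp 2 (normalizedHaar G) ℂ (convolutionKernel f x) := by
    refine (leftRegular_toLp h _).trans (congrArg _ ?_)
    ext y
    simp [convolutionKernel_apply, mul_assoc]
  rw [convolutionOperator_apply, ← hk, leftRegular_inner, convolutionOperator_apply]

theorem inner_toLp_convolutionOperator (f v : C(G, ℂ)) (u : Lp ℂ 2 (normalizedHaar G)) :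
    inner ℂ (ContinuousMap.toLp 2 (normalizedHaar G) ℂ v)
        (ContinuousMap.toLp 2 (normalizedHaar G) ℂ (convolutionOperator f u)) =
      inner ℂ (ContinuousMap.toLp 2 (normalizedHaar G) ℂ
        (∫ x, v x • convolutionKernel f x ∂(normalizedHaar G))) u := by
  let ι : C(G, ℂ) →L[ℂ] Lp ℂ 2 (normalizedHaar G) := ContinuousMap.toLp 2 (normalizedHaar G) ℂ
  have hint : Integrable (fun x => v x • convolutionKernel f x) (normalizedHaar G) :=
    integrable_normalizedHaar (by fun_prop)
  calc inner ℂ (ι v) (ι (convolutionOperator f u))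
      = ∫ x, convolutionOperator f u x * star (v x) ∂(normalizedHaar G) :=
        ContinuousMap.inner_toLp _ _ _
    _ = ∫ x, star (inner ℂ u (ι (v x • convolutionKernel f x))) ∂(normalizedHaar G) := by
        congr with x
        rw [map_smul, inner_smul_right, star_mul', Complex.star_def,
          inner_conj_symm, convolutionOperator_apply, mul_comm]
    _ = star (∫ x, inner ℂ u (ι (v x • convolutionKernel f x)) ∂(normalizedHaar G)) :=
        integral_conj
    _ = star (inner ℂ u (ι (∫ x, v x • convolutionKernel f x ∂(normalizedHaar G)))) := by
        rw [integral_inner (ι.integrable_comp hint), ι.integral_comp_comm hint]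
    _ = _ := inner_conj_symm _ _

theorem convolutionOperator_apply_mul {f : C(G, ℂ)} {π : IrrepMatrix G}
    {e : Fin π.dim → Lp ℂ 2 (normalizedHaar G)}
    (he : TransformsBy (fun g => leftRegular G g) π e) (i : Fin π.dim) (y x : G) :
    star (convolutionOperator f (e i) (y * x)) =
      ∑ j, ∑ l, π.mat y i l * star (convolutionOperator f (e j) 1) * π.mat x l j := by
  have h : convolutionOperator f (e i) (y * x) =
      ∑ j, π.mat (y * x)⁻¹ j i * convolutionOperator f (e j) 1 := by
    have h1 := convolutionOperator_leftRegular f (y * x)⁻¹ (e i) 1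
    rw [inv_inv, mul_one] at h1
    rw [← h1]
    exact (congrArg (convolutionOperator f · 1) (he (y * x)⁻¹ i)).trans (by simp)
  rw [h]
  simp only [π.mat_inv_apply, star_sum, star_mul', star_star, π.mat_mul, Matrix.mul_apply,
    Finset.sum_mul]
  exact Finset.sum_congr rfl fun j _ => Finset.sum_congr rfl fun l _ => by ring

theorem convolutionOperator_eq_zero_of_transformsBy {f : C(G, ℂ)} {π : IrrepMatrix G}
    (hf : ∀ i j, ∫ g, f g * π.mat g i j ∂(normalizedHaar G) = 0)
    {e : Fin π.dim → Lp ℂ 2 (normalizedHaar G)}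
    (he : TransformsBy (fun g => leftRegular G g) π e) (i : Fin π.dim) :
    convolutionOperator f (e i) = 0 := by
  set v := convolutionOperator f (e i) with hv
  have hint : Integrable (fun x => v x • convolutionKernel f x) (normalizedHaar G) :=
    integrable_normalizedHaar (by fun_prop)
  have horth : ∀ y, ∫ x, f x * star (v (y * x)) ∂(normalizedHaar G) = 0 := fun y => by
    have hfl : ∀ c l j, Integrable (fun x => f x * (c * π.mat x l j)) (normalizedHaar G) :=
      fun c l j => integrable_normalizedHaar
        (f.continuous.mul (continuous_const.mul (π.continuous_mat_apply l j)))
    simp only [hv, convolutionOperator_apply_mul he, Finset.mul_sum]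
    rw [integral_finsetSum _ fun j _ => integrable_finsetSum _ fun l _ => hfl _ _ _]
    refine Finset.sum_eq_zero fun j _ => ?_
    rw [integral_finsetSum _ fun l _ => hfl _ _ _]
    refine Finset.sum_eq_zero fun l _ => ?_
    simp only [mul_left_comm (f _), integral_const_mul, hf, mul_zero]
  have hv0 : ∫ x, v x • convolutionKernel f x ∂(normalizedHaar G) = 0 := by
    ext y
    rw [ContinuousMap.integral_apply hint, ContinuousMap.zero_apply, ← star_zero, ← horth y,
      ← integral_mul_left_eq_self _ y]
    refine Eq.trans ?_ integral_conj
    congr with x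
    simp [convolutionKernel_apply, mul_comm]
  refine ContinuousMap.toLp_injective (p := 2) (𝕜 := ℂ) (normalizedHaar G) ?_
  rw [map_zero, ← inner_self_eq_zero (𝕜 := ℂ), hv, inner_toLp_convolutionOperator, ← hv, hv0,
    map_zero, inner_zero_left]

theorem eq_zero_of_convolutionOperator_eq_zero {f : C(G, ℂ)} (hf : convolutionOperator f = 0) :
    f = 0 := by
  have hκ : convolutionKernel f 1 = 0 := by
    refine ContinuousMap.toLp_injective (p := 2) (𝕜 := ℂ) (normalizedHaar G) ?_
    rw [map_zero, ← inner_self_eq_zero (𝕜 := ℂ), ← convolutionOperator_apply, hf]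
    rfl
  ext x
  simpa [convolutionKernel_apply] using DFunLike.congr_fun hκ x⁻¹

theorem eq_zero_of_forall_integral_mul_mat_eq_zero {f : C(G, ℂ)}
    (hf : ∀ (π : GroupDual G) (i j : Fin π.rep.dim),
      ∫ g, f g * π.rep.mat g i j ∂(normalizedHaar G) = 0) : f = 0 := by
  let H := Lp ℂ 2 (normalizedHaar G)
  let ι : C(G, ℂ) →L[ℂ] H := ContinuousMap.toLp 2 (normalizedHaar G) ℂ
  let A : H →L[ℂ] H := ι ∘L convolutionOperator f
  have hA : ∀ g u, A (leftRegular G g u) = leftRegular G g (A u) := fun g u =>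
    (congrArg ι (ContinuousMap.ext (convolutionOperator_leftRegular f g u))).trans
      (leftRegular_toLp g _).symm
  have hconv : IsCompactOperator (convolutionOperator f) := isCompactOperator_innerKernelOperator _
  have hcomp : IsCompactOperator (ContinuousLinearMap.adjoint A ∘L A) :=
    (hconv.clm_comp ι).clm_comp (ContinuousLinearMap.adjoint A)
  have hT : ContinuousLinearMap.adjoint A ∘L A = 0 := by
    refine eq_zero_of_forall_transformsBy leftRegular_inner continuous_leftRegular hcomp
      (IsSelfAdjoint.star_mul_self A).isSymmetric (fun g u => ?_) fun π e he i => ?_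
    · rw [ContinuousLinearMap.comp_apply, hA, apply_adjoint_of_commute leftRegular_inner hA]
      rfl
    · change ContinuousLinearMap.adjoint A (ι (convolutionOperator f (e i))) = 0
      rw [convolutionOperator_eq_zero_of_transformsBy (hf π) he, map_zero, map_zero]
  have hA0 : A = 0 := by
    rw [← CStarRing.star_mul_self_eq_zero_iff]
    exact hT
  exact eq_zero_of_convolutionOperator_eq_zero (ContinuousLinearMap.ext fun u =>
    ContinuousMap.toLp_injective (normalizedHaar G)
      ((DFunLike.congr_fun hA0 u).trans (map_zero ι).symm))

end PeterWeyl

/-! ### The `F`-topology -/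

section WeakTopology

variable {X : Type*} [NonUnitalCStarAlgebra X] {F : Submodule ℂ (StrongDual ℂ X)}

theorem IsDualPair.eq_of_forall_eq (hF : IsDualPair F) {x y : X} (h : ∀ φ ∈ F, φ x = φ y) :
    x = y := by
  rw [← sub_eq_zero, ← norm_le_zero_iff]
  refine (hF.norm_eq (x - y)).2 ?_
  rintro _ ⟨φ, hφ, -, rfl⟩
  rw [map_sub, h φ hφ, sub_self, norm_zero]

theorem IsDualPair.t2Space (hF : IsDualPair F) : @T2Space X (fTopology F) := by
  have hinj : Function.Injective (pairing F) := fun x y h =>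
    hF.eq_of_forall_eq fun φ hφ => LinearMap.congr_fun h ⟨φ, hφ⟩
  exact (WeakBilin.isEmbedding hinj).t2Space

theorem continuous_fTopology_functional {φ : StrongDual ℂ X} (hφ : φ ∈ F) :
    Continuous[fTopology F, _] (fun x : X => φ x) :=
  WeakBilin.eval_continuous (pairing F) ⟨φ, hφ⟩

theorem continuous_fTopology_of_forall {Z : Type*} [TopologicalSpace Z] {u : Z → X}
    (hu : ∀ φ ∈ F, Continuous fun z => φ (u z)) : Continuous[_, fTopology F] u :=
  WeakBilin.continuous_of_continuous_eval (pairing F) fun φ => hu φ φ.2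

theorem isClosed_univ_fTopology : IsClosed[fTopology F] (Set.univ : Set X) :=
  @isClosed_univ X (fTopology F)

theorem exists_functional_comp (T : X →ₗ[ℂ] X)
    (hT : Continuous[fTopology F, fTopology F] (fun x => T x)) {φ : StrongDual ℂ X} (hφ : φ ∈ F) :
    ∃ ψ ∈ F, ∀ x, ψ x = φ (T x) := by
  have hc : Continuous[fTopology F, _] (fun x => φ (T x)) :=
    @Continuous.comp X X ℂ (fTopology F) (fTopology F) _ _ _
      (continuous_fTopology_functional hφ) hT
  let Λ : StrongDual ℂ (WeakBilin (pairing F)) :=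
    { toFun := fun x => φ (T x)
      map_add' := fun x y => (congrArg φ (T.map_add x y)).trans (φ.map_add _ _)
      map_smul' := fun c x => (congrArg φ (T.map_smul c x)).trans (φ.map_smul _ _)
      cont := hc }
  have hsurj : Function.Surjective (WeakBilin.eval (pairing F)) :=
    @LinearMap.dualEmbedding_surjective ℂ X F inferInstance inferInstance inferInstance
      inferInstance inferInstance (pairing F)
  obtain ⟨ψ, hψ⟩ := hsurj Λ
  exact ⟨ψ, ψ.2, fun x => DFunLike.congr_fun hψ x⟩

theorem IsDualPair.isClosed_setOf_eq_zero (hF : IsDualPair F) {T : X → X}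
    (hT : Continuous[fTopology F, fTopology F] T) : IsClosed[fTopology F] {x | T x = 0} :=
  @isClosed_eq X X (fTopology F) (fTopology F) hF.t2Space T (fun _ => 0) hT
    (@continuous_const _ _ (fTopology F) (fTopology F) 0)

theorem IsDualPair.isClosed_leftAnnihilator (hF : IsDualPair F) (S : Set X) :
    IsClosed[fTopology F] (leftAnnihilator S : Set X) := by
  have h : (leftAnnihilator S : Set X) = ⋂ s ∈ S, {x | x * s = 0} :=
    Set.ext fun x => by simp only [SetLike.mem_coe, mem_leftAnnihilator, Set.mem_iInter]; rfl
  rw [h]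
  exact @isClosed_biInter X X (fTopology F) _ _ fun s _ =>
    hF.isClosed_setOf_eq_zero (hF.continuous_mul_right s)

theorem IsDualPair.isClosed_rightAnnihilator (hF : IsDualPair F) (S : Set X) :
    IsClosed[fTopology F] (rightAnnihilator S : Set X) := by
  have h : (rightAnnihilator S : Set X) = ⋂ s ∈ S, {x | s * x = 0} :=
    Set.ext fun x => by simp only [SetLike.mem_coe, mem_rightAnnihilator, Set.mem_iInter]; rfl
  rw [h]
  exact @isClosed_biInter X X (fTopology F) _ _ fun s _ =>
    hF.isClosed_setOf_eq_zero (hF.continuous_mul_left s)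

theorem IsDualPair.isClosed_hereditaryAnnihilator (hF : IsDualPair F) (S : Set X) :
    IsClosed[fTopology F] (hereditaryAnnihilator S : Set X) :=
  @IsClosed.inter X _ _ (fTopology F) (hF.isClosed_rightAnnihilator S)
    (@IsClosed.preimage X X (fTopology F) (fTopology F) _ hF.continuous_star _
      (hF.isClosed_rightAnnihilator S))

theorem continuous_matrixFTopology_apply {d : ℕ} (i j : Fin d) :
    Continuous[matrixFTopology F d, fTopology F]
      (fun x : CStarMatrix (Fin d) (Fin d) X => x i j) := by
  let := fTopology F
  exact continuous_apply_apply i j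

theorem IsDualPair.isClosed_setOf_mul_eq_zero (hF : IsDualPair F) {d : ℕ}
    (b : CStarMatrix (Fin d) (Fin d) X) :
    IsClosed[matrixFTopology F d] {x : CStarMatrix (Fin d) (Fin d) X | b * x = 0} := by
  let := matrixFTopology F d (X := X)
  have hset : {x : CStarMatrix (Fin d) (Fin d) X | b * x = 0} =
      ⋂ i, ⋂ j, ⋂ φ ∈ F, {x | φ ((b * x) i j) = 0} := by
    ext x
    simp only [Set.mem_iInter]
    constructor
    · intro (h : b * x = 0) i j φ _
      change φ ((b * x) i j) = 0
      rw [h, CStarMatrix.zero_apply, map_zero]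
    · exact fun h => CStarMatrix.ext fun i j =>
        hF.eq_of_forall_eq fun φ hφ => (h i j φ hφ).trans (map_zero φ).symm
  rw [hset]
  refine isClosed_iInter fun i => isClosed_iInter fun j => isClosed_biInter fun φ hφ =>
    isClosed_eq ?_ continuous_const
  simp only [CStarMatrix.mul_apply, map_sum]
  refine continuous_finsetSum _ fun k _ => ?_
  exact @Continuous.comp _ X ℂ _ (fTopology F) _ _ _ (continuous_fTopology_functional hφ)
    (@Continuous.comp _ X X _ (fTopology F) (fTopology F) _ _ (hF.continuous_mul_left (b i k))
      (continuous_matrixFTopology_apply k j))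

variable [PartialOrder X] [StarOrderedRing X] {G : Type*} [Group G] [TopologicalSpace G]
  {α : G →* (X ≃⋆ₐ[ℂ] X)}

theorem IsDualPair.mem_specF_iff (hF : IsDualPair F) {Y : NonUnitalStarSubalgebra ℂ X}
    {π : GroupDual G} :
    π ∈ specF F α Y ↔ ∀ b ∈ fixedAlgebra α π.rep Y,
      (∀ a ∈ spectralSubspaceTwo α π.rep Y, a * b = 0) → b = 0 := by
  constructor
  · intro h b hb hab
    rw [← star_eq_zero]
    refine h _ (star_mem hb) fun x hx => ?_
    refine (@closure_minimal _ (matrixFTopology F π.rep.dim) _ _ (fun c hc => ?_)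
      (hF.isClosed_setOf_mul_eq_zero (star b))) hx
    refine (Submodule.span_le (p := rightAnnihilator {star b})).2 ?_ hc _ rfl
    rintro _ ⟨a, ha, d, -, rfl⟩ _ rfl
    rw [← mul_assoc, ← star_mul, hab a ha, star_zero, zero_mul]
  · intro h b hb hbI
    rw [← star_eq_zero]
    refine h _ (star_mem hb) fun a ha => ?_
    rw [← star_eq_zero, star_mul, star_star, ← mul_mul_star_self_eq_zero_iff, star_star]
    exact hbI _ (@subset_closure _ (matrixFTopology F π.rep.dim) _ _
      (Submodule.subset_span ⟨a, ha, a, ha, rfl⟩))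

end WeakTopology

/-! ### Weak integrals -/

section WeakIntegrals

theorem exists_mem_closure_forall_eq_integral {W ι K : Type*} [TopologicalSpace W]
    [AddCommGroup W] [Module ℝ W] [TopologicalSpace K] [CompactSpace K] [MeasurableSpace K]
    [OpensMeasurableSpace K] (μ : Measure K) [IsProbabilityMeasure μ] (p : ι → W →ₗ[ℝ] ℂ)
    (hp : ∀ i, Continuous (p i)) {C : Set W} (hC : Convex ℝ C) (hK : IsCompact (closure C))
    (u : K → W) (hu : ∀ k, u k ∈ C) (hcont : ∀ i, Continuous fun k => p i (u k)) :
    ∃ y ∈ closure C, ∀ i, p i y = ∫ k, p i (u k) ∂μ := by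
  have key := hK.inter_iInter_nonempty (fun i => {y | p i y = ∫ k, p i (u k) ∂μ})
    (fun i => isClosed_eq (hp i) continuous_const) (fun s => ?_)
  · obtain ⟨y, hy, hy'⟩ := key
    exact ⟨y, hy, fun i => Set.mem_iInter.1 hy' i⟩
  · let Φ : W →ₗ[ℝ] (s → ℂ) := LinearMap.pi fun i => p i
    have hΦ : Continuous Φ := continuous_pi fun i => hp i
    have hint : Continuous fun k => Φ (u k) := continuous_pi fun i => hcont i
    have hmem : ∫ k, Φ (u k) ∂μ ∈ closure (Φ '' C) :=
      (hC.linear_image Φ).closure.integral_mem isClosed_closure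
        (Filter.Eventually.of_forall fun k => subset_closure ⟨u k, hu k, rfl⟩)
        (hint.integrable_of_hasCompactSupport (HasCompactSupport.of_compactSpace _))
    have hsub : closure (Φ '' C) ⊆ Φ '' closure C :=
      closure_minimal (Set.image_mono subset_closure) (hK.image hΦ).isClosed
    obtain ⟨y, hy, hyΦ⟩ := hsub hmem
    refine ⟨y, hy, Set.mem_iInter₂.2 fun i hi => ?_⟩
    have := congrFun hyΦ ⟨i, hi⟩
    rw [Set.mem_ofPred_eq]
    refine this.trans ?_
    exact ((ContinuousLinearMap.proj (R := ℝ) (φ := fun _ : s => ℂ) ⟨i, hi⟩).integral_comp_comm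
      (hint.integrable_of_hasCompactSupport (HasCompactSupport.of_compactSpace _))).symm

variable {X : Type*} [NonUnitalCStarAlgebra X] {F : Submodule ℂ (StrongDual ℂ X)}
  {G : Type*} [Group G] [TopologicalSpace G] [IsTopologicalGroup G] [CompactSpace G]
  [MeasurableSpace G] [BorelSpace G]

theorem IsWeakIntegral.unique (hF : IsDualPair F) {f : G → X} {y z : X}
    (hy : IsWeakIntegral F f y) (hz : IsWeakIntegral F f z) : y = z :=
  hF.eq_of_forall_eq fun φ hφ => (hy φ hφ).trans (hz φ hφ).symm

theorem IsWeakIntegral.const_smul {f : G → X} {y : X} (hy : IsWeakIntegral F f y) (c : ℂ) :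
    IsWeakIntegral F (fun g => c • f g) (c • y) := fun φ hφ => by
  simp only [map_smul, integral_smul, hy φ hφ]

theorem IsWeakIntegral.sum {ι : Type*} [Fintype ι] {f : ι → G → X} {y : ι → X}
    (hf : ∀ i, ∀ φ ∈ F, Continuous fun g => φ (f i g)) (hy : ∀ i, IsWeakIntegral F (f i) (y i)) :
    IsWeakIntegral F (fun g => ∑ i, f i g) (∑ i, y i) := fun φ hφ => by
  simp only [map_sum]
  exact (Finset.sum_congr rfl fun i _ => hy i φ hφ).trans
    (integral_finsetSum _ fun i _ => integrable_normalizedHaar (hf i φ hφ)).symm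

theorem isWeakIntegral_comp_mul_left_iff {f : G → X} {y : X} (h : G) :
    IsWeakIntegral F (fun g => f (h * g)) y ↔ IsWeakIntegral F f y :=
  forall₂_congr fun φ _ => by rw [integral_mul_left_eq_self (fun g => φ (f g))]

theorem isWeakIntegral_smul_const (c : G → ℂ) (x : X) :
    IsWeakIntegral F (fun g => c g • x) ((∫ g, c g ∂(normalizedHaar G)) • x) := fun φ _ => by
  simp only [map_smul, smul_eq_mul, integral_mul_const]

theorem IsWeakIntegral.map {f : G → X} {y : X} (hy : IsWeakIntegral F f y) (T : X →ₗ[ℂ] X)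
    (hT : Continuous[fTopology F, fTopology F] (fun x => T x)) :
    IsWeakIntegral F (fun g => T (f g)) (T y) := by
  intro φ hφ
  obtain ⟨ψ, hψ, h⟩ := exists_functional_comp T hT hφ
  simpa only [h] using hy ψ hψ

theorem IsDualPair.exists_isWeakIntegral (hF : IsDualPair F) {Y : Submodule ℂ X}
    (hY : IsClosed[fTopology F] (Y : Set X)) {u : G → X}
    (hu : ∀ φ ∈ F, Continuous fun g => φ (u g)) (huY : ∀ g, u g ∈ Y) :
    ∃ y ∈ Y, IsWeakIntegral F u y := by
  have hrange : IsRelCompact (fTopology F) (Set.range u) :=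
    @IsCompact.closure X (fTopology F) (@T2Space.r1Space X (fTopology F) hF.t2Space) _
      (@isCompact_range G X _ (fTopology F) _ u (continuous_fTopology_of_forall hu))
  obtain ⟨y, hy, hyF⟩ := @exists_mem_closure_forall_eq_integral X F G (fTopology F) _ _ _ _ _ _
    (normalizedHaar G) _ (fun φ => (φ.1.toLinearMap).restrictScalars ℝ)
    (fun φ => continuous_fTopology_functional φ.2) _ (convex_convexHull ℝ (Set.range u))
    (hF.convexHull_relCompact _ hrange) u (fun g => subset_convexHull ℝ _ ⟨g, rfl⟩)
    (fun φ => hu φ φ.2)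
  refine ⟨y, ?_, fun φ hφ => hyF ⟨φ, hφ⟩⟩
  exact (@closure_minimal X (fTopology F) _ _
    (convexHull_min (Set.range_subset_iff.2 huY) (Y.restrictScalars ℝ).convex) hY) hy

end WeakIntegrals

/-! ### Fourier coefficients -/

section FourierAnalysis

variable {X : Type*} [NonUnitalCStarAlgebra X] {F : Submodule ℂ (StrongDual ℂ X)}
  {G : Type*} [Group G] [TopologicalSpace G] [IsTopologicalGroup G] [CompactSpace G]
  [MeasurableSpace G] [BorelSpace G] {α : G →* (X ≃⋆ₐ[ℂ] X)}

theorem IrrepMatrix.star_mat_apply_eq_sum {G : Type*} [Group G] [TopologicalSpace G]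
    (π : IrrepMatrix G) (h g : G) (i j : Fin π.dim) :
    star (π.mat g j i) = ∑ k, π.mat h k j * star (π.mat (h * g) k i) := by
  conv_lhs => rw [← inv_mul_cancel_left h g, π.mat_mul, Matrix.mul_apply]
  simp only [π.mat_inv_apply, star_sum, star_mul', star_star]

theorem IsFDynamicalSystem.mem_spectralSubspaceTwo_of_isWeakIntegral
    (hα : IsFDynamicalSystem F α) {π : IrrepMatrix G} {x : X}
    {a : CStarMatrix (Fin π.dim) (Fin π.dim) X} {Y : NonUnitalStarSubalgebra ℂ X}
    (haY : ∀ i j, a i j ∈ Y)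
    (ha : ∀ i j, IsWeakIntegral F (fun g => star (π.mat g j i) • α g x) (a i j)) :
    a ∈ spectralSubspaceTwo α π Y := by
  refine ⟨haY, fun h => CStarMatrix.ext fun i j => ?_⟩
  rw [entrywise_apply, rmulScalar_apply]
  have hleft := (ha i j).map ((α h : X ≃⋆ₐ[ℂ] X) : X →ₗ[ℂ] X) (hα.continuous_aut h)
  have hright : IsWeakIntegral F (fun g => ∑ k, π.mat h k j • star (π.mat g k i) • α g x)
      (∑ k, π.mat h k j • a i k) := by
    refine IsWeakIntegral.sum (fun k φ hφ => ?_) fun k => (ha i k).const_smul _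
    simp only [map_smul]
    exact ((π.continuous_star_mat_apply k i).smul
      (hα.continuous_orbit φ hφ x)).const_smul (π.mat h k j)
  refine hleft.unique hα.dualPair ?_
  convert (isWeakIntegral_comp_mul_left_iff h).2 hright using 2 with g
  change α h (star (π.mat g j i) • α g x) = _
  simp only [smul_smul, ← Finset.sum_smul, ← π.star_mat_apply_eq_sum, map_smul, map_mul,
    StarAlgEquiv.mul_apply]

theorem IsFDynamicalSystem.exists_fourierMatrix (hα : IsFDynamicalSystem F α)
    {Y : Submodule ℂ X} (hY : IsClosed[fTopology F] (Y : Set X))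
    (hYα : ∀ g, ∀ y ∈ Y, α g y ∈ Y) (π : IrrepMatrix G) {x : X} (hx : x ∈ Y) :
    ∃ a ∈ spectralSubspaceTwo α π ⊤, (∀ i j, a i j ∈ Y) ∧
      ∀ i j, IsWeakIntegral F (fun g => star (π.mat g j i) • α g x) (a i j) := by
  choose a haY ha using fun i j => hα.dualPair.exists_isWeakIntegral hY
    (u := fun g => star (π.mat g j i) • α g x)
    (fun φ hφ => by
      simp only [map_smul]
      exact (π.continuous_star_mat_apply j i).smul (hα.continuous_orbit φ hφ x))
    fun g => Y.smul_mem _ (hYα g x hx)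
  exact ⟨CStarMatrix.ofMatrix a,
    hα.mem_spectralSubspaceTwo_of_isWeakIntegral (fun _ _ => trivial) ha, haY, ha⟩

theorem IsFDynamicalSystem.functional_eq_zero_of_forall_spectral
    (hα : IsFDynamicalSystem F α) {Y : Submodule ℂ X} (hY : IsClosed[fTopology F] (Y : Set X))
    (hYα : ∀ g, ∀ y ∈ Y, α g y ∈ Y) {φ : StrongDual ℂ X} (hφ : φ ∈ F)
    (h : ∀ π : GroupDual G, ∀ a ∈ spectralSubspaceTwo α π.rep ⊤, (∀ i j, a i j ∈ Y) →
      ∀ i j, φ (a i j) = 0) {x : X} (hx : x ∈ Y) : φ x = 0 := by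
  let f : C(G, ℂ) := ⟨fun g => star (φ (α g x)), (hα.continuous_orbit φ hφ x).star⟩
  have hf : f = 0 := eq_zero_of_forall_integral_mul_mat_eq_zero fun π i j => by
    obtain ⟨a, ha, haY, hint⟩ := hα.exists_fourierMatrix hY hYα π.rep hx
    have hfg : ∀ g, f g * π.rep.mat g i j = star (φ (star (π.rep.mat g i j) • α g x)) :=
      fun g => by
        rw [map_smul, smul_eq_mul, star_mul', star_star, mul_comm]
        rfl
    simp only [hfg]
    refine (integral_conj (f := fun g => φ (star (π.rep.mat g i j) • α g x))).trans ?_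
    rw [normalizedHaar, ← hint j i φ hφ, h π a ha haY, map_zero]
  have hf1 := DFunLike.congr_fun hf 1
  simpa [f] using hf1

theorem IsFDynamicalSystem.apply_eq_zero_of_forall_spectral
    (hα : IsFDynamicalSystem F α) {Y : Submodule ℂ X} (hY : IsClosed[fTopology F] (Y : Set X))
    (hYα : ∀ g, ∀ y ∈ Y, α g y ∈ Y) {T : X →ₗ[ℂ] X}
    (hT : Continuous[fTopology F, fTopology F] (fun x => T x))
    (h : ∀ π : GroupDual G, ∀ a ∈ spectralSubspaceTwo α π.rep ⊤, (∀ i j, a i j ∈ Y) →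
      ∀ i j, T (a i j) = 0) {x : X} (hx : x ∈ Y) : T x = 0 :=
  hα.dualPair.eq_of_forall_eq fun φ hφ => by
    obtain ⟨ψ, hψ, hψT⟩ := exists_functional_comp T hT hφ
    rw [map_zero, ← hψT]
    refine hα.functional_eq_zero_of_forall_spectral hY hYα hψ (fun π a ha haY i j => ?_) hx
    rw [hψT, h π a ha haY, map_zero]

theorem IrrepMatrix.continuous_chi {G : Type*} [Group G] [TopologicalSpace G]
    (π : IrrepMatrix G) : Continuous π.chi :=
  continuous_const.mul (continuous_finsetSum _ fun i _ => π.continuous_star_mat_apply i i)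

theorem IrrepMatrix.integral_chi_mul_mat (π : IrrepMatrix G) (k j : Fin π.dim) :
    ∫ g, π.chi g * π.mat g k j ∂(normalizedHaar G) = if k = j then 1 else 0 := by
  have hint : ∀ i, Integrable (fun g => π.mat g k j * star (π.mat g i i)) (normalizedHaar G) :=
    fun i => integrable_normalizedHaar
      ((π.continuous_mat_apply k j).mul (π.continuous_star_mat_apply i i))
  calc ∫ g, π.chi g * π.mat g k j ∂(normalizedHaar G)
      = ∫ g, (π.dim : ℂ) * ∑ i, π.mat g k j * star (π.mat g i i) ∂(normalizedHaar G) := by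
        refine integral_congr_ae (.of_forall fun g => ?_)
        simp only [IrrepMatrix.chi, mul_assoc, Finset.sum_mul, mul_comm (π.mat g k j)]
    _ = ∑ i, if k = i ∧ j = i then 1 else 0 := by
        rw [integral_const_mul, integral_finsetSum _ fun i _ => hint i, Finset.mul_sum]
        exact Finset.sum_congr rfl fun i _ => π.integral_mat_mul_star_mat k i j i
    _ = if k = j then 1 else 0 := by
        simp only [ite_and, Finset.sum_ite_eq, Finset.mem_univ, if_true, eq_comm]

theorem IsFDynamicalSystem.exists_spectralSubspaceTwo_ne_zero (hα : IsFDynamicalSystem F α)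
    {π : IrrepMatrix G} {x : X} (hx : x ∈ spectralSubspaceOne F α π) (hx0 : x ≠ 0) :
    ∃ a ∈ spectralSubspaceTwo α π ⊤, a ≠ 0 := by
  obtain ⟨a, ha, -, hint⟩ := hα.exists_fourierMatrix (Y := ⊤) isClosed_univ_fTopology
    (fun _ _ _ => trivial) π (x := x) trivial
  refine ⟨a, ha, ?_⟩
  rintro rfl
  have hsum : IsWeakIntegral F (fun g => (π.dim : ℂ) • ∑ i, star (π.mat g i i) • α g x)
      ((π.dim : ℂ) • ∑ _i : Fin π.dim, 0) :=
    .const_smul (.sum (fun i φ hφ => by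
      simp only [map_smul]
      exact (π.continuous_star_mat_apply i i).smul (hα.continuous_orbit φ hφ x))
      fun i => hint i i) _
  refine hx0 (IsWeakIntegral.unique hα.dualPair hx ?_)
  simpa only [IrrepMatrix.chi, ← Finset.sum_smul, smul_smul, Finset.sum_const_zero, smul_zero]
    using hsum

theorem apply_mem_spectralSubspaceOne {π : IrrepMatrix G}
    {a : CStarMatrix (Fin π.dim) (Fin π.dim) X} (ha : a ∈ spectralSubspaceTwo α π ⊤)
    (i j : Fin π.dim) : a i j ∈ spectralSubspaceOne F α π := by
  have hcont : ∀ k, ∀ φ ∈ F, Continuous fun g => φ ((π.chi g * π.mat g k j) • a i k) :=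
    fun k φ _ => by
      simp only [map_smul]
      exact (π.continuous_chi.mul (π.continuous_mat_apply k j)).smul continuous_const
  have hsum := IsWeakIntegral.sum hcont fun k => isWeakIntegral_smul_const _ (a i k)
  simp only [π.integral_chi_mul_mat, ite_smul, one_smul, zero_smul, Finset.sum_ite_eq',
    Finset.mem_univ, if_true] at hsum
  have hexpand : ∀ g, π.chi g • α g (a i j) = ∑ k, (π.chi g * π.mat g k j) • a i k := fun g => by
    rw [← entrywise_apply, ha.2 g, rmulScalar_apply, Finset.smul_sum]
    simp only [smul_smul]
  change IsWeakIntegral F _ _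
  simpa only [hexpand] using hsum

theorem IsFDynamicalSystem.mem_spec_iff (hα : IsFDynamicalSystem F α) {π : GroupDual G} :
    π ∈ spec F α ↔ ∃ a ∈ spectralSubspaceTwo α π.rep ⊤, a ≠ 0 := by
  constructor
  · intro h
    by_contra! h0
    refine h (Set.eq_singleton_iff_unique_mem.2 ⟨fun φ _ => by simp, fun x hx => ?_⟩)
    by_contra hx0
    obtain ⟨a, ha, ha0⟩ := hα.exists_spectralSubspaceTwo_ne_zero hx hx0
    exact ha0 (h0 a ha)
  · rintro ⟨a, ha, ha0⟩ h
    obtain ⟨i, j, hij⟩ := exists_apply_ne_zero ha0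
    have hmem := apply_mem_spectralSubspaceOne (F := F) ha i j
    rw [h] at hmem
    exact hij hmem

theorem IsFDynamicalSystem.exists_fixedPoints_ne_zero [PartialOrder X] [StarOrderedRing X]
    (hα : IsFDynamicalSystem F α) {Y : Submodule ℂ X}
    (hY : IsClosed[fTopology F] (Y : Set X)) (hYα : ∀ g, ∀ y ∈ Y, α g y ∈ Y)
    (hYmul : ∀ y ∈ Y, ∀ z ∈ Y, y * star z ∈ Y) (hY0 : Y ≠ ⊥) :
    ∃ p ∈ Y, p ∈ fixedPoints α ∧ p ≠ 0 := by
  obtain ⟨x, hx, hx0⟩ := Y.exists_mem_ne_zero_of_ne_bot hY0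
  obtain ⟨π, a, ha, haY, ha0⟩ : ∃ π : GroupDual G, ∃ a ∈ spectralSubspaceTwo α π.rep ⊤,
      (∀ i j, a i j ∈ Y) ∧ a ≠ 0 := by
    by_contra! hcon
    refine hx0 (hα.apply_eq_zero_of_forall_spectral hY hYα (T := LinearMap.id)
      (@continuous_id X (fTopology F)) (fun π a ha haY i j => ?_) hx)
    rw [hcon π a ha haY]
    rfl
  obtain ⟨i, j, hij⟩ := exists_apply_ne_zero
    (mt (CStarRing.mul_star_self_eq_zero_iff a).1 ha0)
  refine ⟨_, ?_, mul_star_mem_matrixSubalgebra_fixedPoints ha ha i j, hij⟩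
  rw [CStarMatrix.mul_apply]
  exact sum_mem fun k _ => hYmul _ (haY i k) _ (haY j k)

theorem IsFDynamicalSystem.exists_fixedPoints_ne_zero_of_nontrivial [PartialOrder X]
    [StarOrderedRing X] [Nontrivial X] (hα : IsFDynamicalSystem F α) :
    ∃ p ∈ fixedPoints α, p ≠ 0 := by
  obtain ⟨p, -, hp⟩ := hα.exists_fixedPoints_ne_zero (Y := ⊤) isClosed_univ_fTopology
    (fun _ _ _ => trivial) (fun _ _ _ _ => trivial) top_ne_bot
  exact ⟨p, hp⟩

end FourierAnalysis

/-! ### Primeness and the Connes spectrum -/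

section SpectralPrimeness

variable {X : Type*} [NonUnitalCStarAlgebra X] [PartialOrder X] [StarOrderedRing X] {G : Type*}
  [Group G] [TopologicalSpace G] {α : G →* (X ≃⋆ₐ[ℂ] X)} {π : IrrepMatrix G}

theorem diagonalOf_mul_mul_eq_zero_of_hereditary {Y : NonUnitalStarSubalgebra ℂ X}
    (hY : ∀ x y : X, 0 ≤ x → x ≤ y → y ∈ Y → x ∈ Y) {p : X} (hp : p ∈ fixedPoints α)
    (hpY : p ∈ Y) {a b : CStarMatrix (Fin π.dim) (Fin π.dim) X} (hb : b ∈ fixedAlgebra α π Y)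
    (hYb : ∀ y ∈ spectralSubspaceTwo α π Y, y * b = 0) (ha : a ∈ spectralSubspaceTwo α π ⊤) :
    diagonalOf π.dim p * a * b = 0 := by
  have hbb : b * star b ∈ fixedAlgebra α π Y := mul_mem hb (star_mem hb)
  have hPa := fixedPoints_mul_mem_spectralSubspaceTwo (diagonalOf_mem_matrixSubalgebra hp) ha
  have hmem : diagonalOf π.dim p * a * (b * star b) ∈ spectralSubspaceTwo α π Y := by
    refine ⟨fun i j => ?_, (mul_mem_spectralSubspaceTwo hPa (fixedAlgebra_le_top hbb)).2⟩
    rw [CStarMatrix.mul_apply]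
    refine sum_mem fun k _ => ?_
    rw [diagonalOf_mul_apply]
    exact mul_mul_mem_of_hereditary hY hpY (hbb.1 k j) _
  rw [← mul_mul_star_self_eq_zero_iff, ← mul_assoc, ← mul_mul_star_self_eq_zero_iff, star_star]
  simpa only [mul_assoc] using hYb _ hmem

theorem eq_zero_of_forall_spectralSubspaceTwo_mul_eq_zero {Y : NonUnitalStarSubalgebra ℂ X}
    (hfixed : IsFPrime (fixedPoints α)) (hπ : IsFPrime (fixedAlgebra α π ⊤))
    {e : CStarMatrix (Fin π.dim) (Fin π.dim) X} (he : e ∈ spectralSubspaceTwo α π ⊤) (he0 : e ≠ 0)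
    (hY : ∀ x y : X, 0 ≤ x → x ≤ y → y ∈ Y → x ∈ Y) {p : X} (hp : p ∈ fixedPoints α)
    (hpY : p ∈ Y) (hp0 : p ≠ 0) {b : CStarMatrix (Fin π.dim) (Fin π.dim) X}
    (hb : b ∈ fixedAlgebra α π Y) (hYb : ∀ y ∈ spectralSubspaceTwo α π Y, y * b = 0) : b = 0 := by
  by_contra hb0
  obtain ⟨c, hc, hecb⟩ : ∃ c ∈ fixedAlgebra α π ⊤, e * c * b ≠ 0 := by
    by_contra! hcon
    refine (isFPrime_iff.1 hπ _ (star_mul_mem_fixedAlgebra he he) b (fixedAlgebra_le_top hb)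
      fun c hc => ?_).elim (fun h => he0 ((CStarRing.star_mul_self_eq_zero_iff e).1 h)) hb0
    rw [mul_assoc, mul_assoc, ← mul_assoc e, hcon c hc, mul_zero]
  have hec : e * c ∈ spectralSubspaceTwo α π ⊤ := mul_mem_spectralSubspaceTwo he hc
  have hecb' := mul_mem_spectralSubspaceTwo hec (fixedAlgebra_le_top hb)
  refine (isFPrime_iff.1 ((isFPrime_matrixSubalgebra_iff π.dim_pos).2 hfixed) _
    (diagonalOf_mem_matrixSubalgebra hp) _
    (mul_star_mem_matrixSubalgebra_fixedPoints hecb' hecb') fun Z hZ => ?_).elim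
    (fun h => hp0 ((diagonalOf_eq_zero_iff π.dim_pos).1 h))
    (fun h => hecb ((CStarRing.mul_star_self_eq_zero_iff _).1 h))
  rw [mul_mul_star_self_eq_zero_iff, mul_assoc, ← mul_assoc Z, ← mul_assoc]
  exact diagonalOf_mul_mul_eq_zero_of_hereditary hY hp hpY hb hYb
    (fixedPoints_mul_mem_spectralSubspaceTwo hZ hec)

theorem diagonalOf_mul_mul_diagonalOf_eq_zero {p q : X} (hp : p ∈ fixedPoints α)
    (hq : q ∈ fixedPoints α)
    (hqY : q ∈ hereditaryAnnihilator {x | ∃ z ∈ fixedPoints α, x = p * z})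
    (hess : ∀ b ∈ fixedAlgebra α π (hereditaryAnnihilator {x | ∃ z ∈ fixedPoints α, x = p * z}),
      (∀ a ∈ spectralSubspaceTwo α π (hereditaryAnnihilator {x | ∃ z ∈ fixedPoints α, x = p * z}),
        a * b = 0) → b = 0)
    {a : CStarMatrix (Fin π.dim) (Fin π.dim) X} (ha : a ∈ spectralSubspaceTwo α π ⊤) :
    diagonalOf π.dim p * (a * diagonalOf π.dim q) = 0 := by
  set Y := hereditaryAnnihilator {x | ∃ z ∈ fixedPoints α, x = p * z}
  set P := diagonalOf π.dim p
  set v := a * diagonalOf π.dim q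
  have hv : v ∈ spectralSubspaceTwo α π ⊤ :=
    mul_mem_spectralSubspaceTwo ha (diagonalOf_mem_fixedAlgebra hq trivial)
  have hPv : P * v ∈ spectralSubspaceTwo α π ⊤ :=
    fixedPoints_mul_mem_spectralSubspaceTwo (diagonalOf_mem_matrixSubalgebra hp) hv
  have hstar : star (P * v) * (P * v) ∈ fixedAlgebra α π Y := by
    refine ⟨fun i j => ?_, (star_mul_mem_fixedAlgebra hPv hPv).2⟩
    have hQ : star (P * v) * (P * v) =
        diagonalOf π.dim (star q) * (star (P * a) * (P * a) * diagonalOf π.dim q) := by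
      simp only [v, star_mul, star_diagonalOf, mul_assoc]
    rw [hQ, diagonalOf_mul_apply, mul_diagonalOf_apply, ← mul_assoc]
    exact mul_mul_mem_of_hereditary (fun x y hx hxy => mem_hereditaryAnnihilator_of_nonneg_of_le
      hx hxy) (star_mem hqY) hqY _
  have hyv : ∀ y ∈ spectralSubspaceTwo α π Y, y * star (P * v) = 0 := fun y hy => by
    have hM := mul_star_mem_matrixSubalgebra_fixedPoints hv (spectralSubspaceTwo_subset_top hy)
    have hPMy : P * (v * star y) * y = 0 := CStarMatrix.ext fun i j => by
      rw [CStarMatrix.mul_apply]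
      refine Finset.sum_eq_zero fun k _ => ?_
      rw [diagonalOf_mul_apply]
      exact (hy.1 k j).1 _ ⟨_, hM i k, rfl⟩
    have hPvy : P * v * star y = 0 := by
      rw [← CStarRing.mul_star_self_eq_zero_iff, star_mul, star_star, mul_assoc P v, ← mul_assoc,
        hPMy, zero_mul]
    rw [← star_eq_zero, star_mul, star_star, hPvy]
  refine (CStarRing.star_mul_self_eq_zero_iff _).1 (hess _ hstar fun y hy => ?_)
  rw [← mul_assoc, hyv y hy, zero_mul]

theorem isFPrime_fixedAlgebra_of_isFPrime_fixedPoints (hfixed : IsFPrime (fixedPoints α))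
    (hess : ∀ b ∈ fixedAlgebra α π ⊤, (∀ a ∈ spectralSubspaceTwo α π ⊤, a * b = 0) → b = 0) :
    IsFPrime (fixedAlgebra α π ⊤) := by
  refine isFPrime_iff.2 fun b hb c hc hbc => ?_
  by_contra! h0
  obtain ⟨a, ha, hab⟩ : ∃ a ∈ spectralSubspaceTwo α π ⊤, a * star b ≠ 0 := by
    by_contra! hcon
    exact h0.1 (star_eq_zero.1 (hess _ (star_mem hb) hcon))
  obtain ⟨e, he, hec⟩ : ∃ e ∈ spectralSubspaceTwo α π ⊤, e * c ≠ 0 := by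
    by_contra! hcon
    exact h0.2 (hess c hc hcon)
  have hu := mul_mem_spectralSubspaceTwo ha (star_mem hb)
  have hv := mul_mem_spectralSubspaceTwo he hc
  refine (isFPrime_iff.1 ((isFPrime_matrixSubalgebra_iff π.dim_pos).2 hfixed) _
    (mul_star_mem_matrixSubalgebra_fixedPoints hu hu) _
    (mul_star_mem_matrixSubalgebra_fixedPoints hv hv) fun Z hZ => ?_).elim
    (fun h => hab ((CStarRing.mul_star_self_eq_zero_iff _).1 h))
    (fun h => hec ((CStarRing.mul_star_self_eq_zero_iff _).1 h))
  have hmiddle : star (a * star b) * Z * (e * c) = 0 := by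
    simpa only [star_mul, star_star, mul_assoc] using
      hbc _ (star_mul_mem_fixedAlgebra ha (fixedPoints_mul_mem_spectralSubspaceTwo hZ he))
  rw [mul_mul_star_self_eq_zero_iff, mul_assoc, mul_assoc, ← mul_assoc _ Z, hmiddle, mul_zero]

end SpectralPrimeness

section InvariantHereditary

variable {X : Type*} [NonUnitalCStarAlgebra X] [PartialOrder X] {F : Submodule ℂ (StrongDual ℂ X)}
  {G : Type*} [Group G] {α : G →* (X ≃⋆ₐ[ℂ] X)}

theorem isInvariantHereditary_top [Nontrivial X] : IsInvariantHereditary F α ⊤ where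
  nonzero := (exists_ne 0).imp fun _ hx => ⟨trivial, hx⟩
  invariant _ _ _ := trivial
  isClosed := isClosed_univ_fTopology
  hereditary _ _ _ _ _ := trivial

theorem IsDualPair.isInvariantHereditary_hereditaryAnnihilator [StarOrderedRing X]
    (hF : IsDualPair F) {S : Set X} (hS : ∀ g, ∀ s ∈ S, α g s ∈ S) {x : X}
    (hx : x ∈ hereditaryAnnihilator S) (hx0 : x ≠ 0) :
    IsInvariantHereditary F α (hereditaryAnnihilator S) where
  nonzero := ⟨x, hx, hx0⟩
  invariant g y hy := ⟨map_mem_rightAnnihilator hS g hy.1, by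
    rw [← map_star]
    exact map_mem_rightAnnihilator hS g hy.2⟩
  isClosed := hF.isClosed_hereditaryAnnihilator S
  hereditary _ _ hx hxy hy := mem_hereditaryAnnihilator_of_nonneg_of_le hx hxy hy

end InvariantHereditary

section DynamicalSystem

variable {X : Type*} [NonUnitalCStarAlgebra X] [PartialOrder X] [StarOrderedRing X]
  {F : Submodule ℂ (StrongDual ℂ X)} {G : Type*} [Group G] [TopologicalSpace G]
  [IsTopologicalGroup G] [CompactSpace G] [MeasurableSpace G] [BorelSpace G]
  {α : G →* (X ≃⋆ₐ[ℂ] X)} (hα : IsFDynamicalSystem F α)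
include hα

theorem IsFDynamicalSystem.isFPrime_fixedPoints [Nontrivial X]
    (h : ∀ π ∈ spec F α, IsFPrime (fixedAlgebra α π.rep ⊤)) : IsFPrime (fixedPoints α) := by
  obtain ⟨π, hπ⟩ := exists_rep_mat_eq_one G
  obtain ⟨p, hp, hp0⟩ := hα.exists_fixedPoints_ne_zero_of_nontrivial
  have hspec : π ∈ spec F α := by
    refine hα.mem_spec_iff.2 ⟨diagonalOf _ p, ⟨fun _ _ => trivial, fun g => ?_⟩,
      (diagonalOf_eq_zero_iff π.rep.dim_pos).not.2 hp0⟩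
    rw [hπ, rmulScalar_one]
    exact mem_matrixSubalgebra_fixedPoints_iff.1 (diagonalOf_mem_matrixSubalgebra hp) g
  rw [← isFPrime_matrixSubalgebra_iff π.rep.dim_pos, ← fixedAlgebra_top_eq_matrixSubalgebra hπ]
  exact h π hspec

theorem IsFDynamicalSystem.isActionPrime_of_isFPrime_fixedPoints
    (h : IsFPrime (fixedPoints α)) : IsActionPrime α := by
  intro I hI hIα hI0 b _ hb
  by_contra hb0
  have hF := hα.dualPair
  have hA : ∀ y ∈ leftAnnihilator (I : Set X), ∀ x, y * x ∈ leftAnnihilator (I : Set X) :=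
    fun y hy x z hz => by
      rw [mul_assoc]
      exact hy _ (hI.2 x trivial z hz).1
  have hAα := fun g y => map_mem_leftAnnihilator (x := y) hIα g
  obtain ⟨p, hpA, hp, hp0⟩ := hα.exists_fixedPoints_ne_zero (hF.isClosed_leftAnnihilator I) hAα
    (fun y hy z _ => hA y hy _) ((Submodule.ne_bot_iff _).2 ⟨b, hb, hb0⟩)
  obtain ⟨c, hcI, hc0⟩ := (Submodule.ne_bot_iff I).1 hI0
  obtain ⟨q, hqC, hq, hq0⟩ := hα.exists_fixedPoints_ne_zero
    (hF.isClosed_rightAnnihilator (leftAnnihilator (I : Set X)))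
    (fun g y hy => map_mem_rightAnnihilator hAα g hy)
    (fun y hy z _ w hw => by rw [← mul_assoc, hy w hw, zero_mul])
    ((Submodule.ne_bot_iff _).2 ⟨c, fun y hy => hy c hcI, hc0⟩)
  exact (isFPrime_iff.1 h p hp q hq fun z _ => hqC _ (hA p hpA z)).elim hp0 hq0

theorem IsFDynamicalSystem.connesSpectrum_subset_spec [Nontrivial X] :
    connesSpectrum F α ⊆ spec F α := by
  intro π hπ
  rw [hα.mem_spec_iff]
  by_contra! hcon
  obtain ⟨p, hp, hp0⟩ := hα.exists_fixedPoints_ne_zero_of_nontrivial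
  refine hp0 ((diagonalOf_eq_zero_iff π.rep.dim_pos).1
    (hα.dualPair.mem_specF_iff.1 (hπ ⊤ isInvariantHereditary_top) _
      (diagonalOf_mem_fixedAlgebra hp trivial) fun a ha => ?_))
  rw [hcon a ha, zero_mul]

theorem IsFDynamicalSystem.spec_subset_connesSpectrum [Nontrivial X]
    (h : ∀ π ∈ spec F α, IsFPrime (fixedAlgebra α π.rep ⊤)) : spec F α ⊆ connesSpectrum F α := by
  intro π hπ Y hY
  obtain ⟨e, he, he0⟩ := hα.mem_spec_iff.1 hπ
  obtain ⟨y, hy, hy0⟩ := hY.nonzero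
  obtain ⟨p, hpY, hp, hp0⟩ := hα.exists_fixedPoints_ne_zero
    (Y := Y.toNonUnitalSubalgebra.toSubmodule) hY.isClosed hY.invariant
    (fun _ hy _ hz => mul_mem (s := Y) hy (star_mem (s := Y) hz))
    ((Submodule.ne_bot_iff _).2 ⟨y, hy, hy0⟩)
  exact hα.dualPair.mem_specF_iff.2 fun b hb => eq_zero_of_forall_spectralSubspaceTwo_mul_eq_zero
    (hα.isFPrime_fixedPoints h) (h π hπ) he he0 hY.hereditary hp hpY hp0 hb

theorem IsFDynamicalSystem.mul_mul_eq_zero_of_spec_subset (hsub : spec F α ⊆ connesSpectrum F α)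
    {p q : X} (hp : p ∈ fixedPoints α) (hq : q ∈ fixedPoints α)
    (hqY : q ∈ hereditaryAnnihilator {x | ∃ z ∈ fixedPoints α, x = p * z}) (x : X) :
    p * x * q = 0 := by
  rcases eq_or_ne q 0 with rfl | hq0
  · rw [mul_zero]
  have hF := hα.dualPair
  have hY : IsInvariantHereditary F α _ := hF.isInvariantHereditary_hereditaryAnnihilator
    (by rintro g _ ⟨z, hz, rfl⟩; exact ⟨z, hz, mul_mem hp hz g⟩) hqY hq0
  have hcont : Continuous[fTopology F, fTopology F] fun x => p * x * q :=
    @Continuous.comp X X X (fTopology F) (fTopology F) (fTopology F) _ _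
      (hF.continuous_mul_right q) (hF.continuous_mul_left p)
  refine hα.apply_eq_zero_of_forall_spectral (Y := ⊤) isClosed_univ_fTopology
    (fun _ _ _ => trivial) (T := (LinearMap.mulRight ℂ q).comp (LinearMap.mulLeft ℂ p)) hcont
    (fun π a ha _ i j => ?_) trivial
  rcases eq_or_ne a 0 with rfl | ha0
  · exact map_zero _
  have hπ : π ∈ connesSpectrum F α := hsub (hα.mem_spec_iff.2 ⟨a, ha, ha0⟩)
  have hPaQ := diagonalOf_mul_mul_diagonalOf_eq_zero hp hq hqY (hF.mem_specF_iff.1 (hπ _ hY)) ha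
  change p * a i j * q = 0
  rw [mul_assoc, ← mul_diagonalOf_apply, ← diagonalOf_mul_apply, hPaQ, CStarMatrix.zero_apply]

theorem IsFDynamicalSystem.isFPrime_fixedPoints_of_spec_subset (hprime : IsActionPrime α)
    (hsub : spec F α ⊆ connesSpectrum F α) : IsFPrime (fixedPoints α) := by
  refine isFPrime_iff.2 fun p hp q hq hpq => or_iff_not_imp_right.2 fun hq0 => ?_
  have hqq : q * star q ∈ fixedPoints α := mul_mem hq (star_mem hq)
  have hqq0 : q * star q ≠ 0 := (CStarRing.mul_star_self_eq_zero_iff q).not.2 hq0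
  have hqqS : q * star q ∈ rightAnnihilator {x | ∃ z ∈ fixedPoints α, x = p * z} := by
    rintro _ ⟨z, hz, rfl⟩
    rw [← mul_assoc, hpq z hz, zero_mul]
  have hpXq := hα.mul_mul_eq_zero_of_spec_subset hsub hp hqq
    ⟨hqqS, by rwa [star_mul, star_star]⟩
  let I := rightAnnihilator (Set.range (p * ·))
  have hI : IsTwoSidedIdealIn ⊤ I := by
    refine ⟨fun _ _ => trivial, fun b _ x hx => ⟨?_, fun s hs => ?_⟩⟩
    · rintro _ ⟨y, rfl⟩
      rw [← mul_assoc, mul_assoc p]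
      exact hx _ ⟨y * b, rfl⟩
    · rw [← mul_assoc, hx s hs, zero_mul]
  have hIα : ∀ g, ∀ x ∈ I, α g x ∈ I := fun g x => map_mem_rightAnnihilator
    (by rintro g _ ⟨y, rfl⟩; exact ⟨α g y, by rw [map_mul, hp g]⟩) g
  have hqqI : q * star q ∈ I := by
    rintro _ ⟨y, rfl⟩
    exact hpXq y
  refine (CStarRing.mul_star_self_eq_zero_iff p).1 ?_
  exact hprime I hI hIα ((Submodule.ne_bot_iff I).2 ⟨_, hqqI, hqq0⟩) _ trivial
    fun x hx => hx _ ⟨star p, rfl⟩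

end DynamicalSystem

end CompactAction

end

theorem theorem4p3_general {X : Type*} [NonUnitalCStarAlgebra X] [PartialOrder X]
    [StarOrderedRing X] [Nontrivial X] {G : Type*} [Group G] [TopologicalSpace G]
    [IsTopologicalGroup G] [CompactSpace G] [MeasurableSpace G] [BorelSpace G]
    (F : Submodule ℂ (StrongDual ℂ X)) (α : G →* (X ≃⋆ₐ[ℂ] X)) (hα : IsFDynamicalSystem F α) :
    (∀ π ∈ spec F α, IsFPrime (fixedAlgebra α π.rep ⊤)) ↔
      (IsActionPrime α ∧ spec F α = connesSpectrum F α) := by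
  constructor
  · intro h
    exact ⟨hα.isActionPrime_of_isFPrime_fixedPoints (hα.isFPrime_fixedPoints h),
      (hα.spec_subset_connesSpectrum h).antisymm hα.connesSpectrum_subset_spec⟩
  · rintro ⟨hprime, hspec⟩ π hπ
    have hfixed := hα.isFPrime_fixedPoints_of_spec_subset hprime hspec.le
    exact isFPrime_fixedAlgebra_of_isFPrime_fixedPoints hfixed
      (hα.dualPair.mem_specF_iff.1 ((hspec ▸ hπ) ⊤ isInvariantHereditary_top))

theorem theorem4p3 {X : Type*} [NonUnitalCStarAlgebra X] [PartialOrder X] [StarOrderedRing X]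
    [Nontrivial X] {G : Type*} [Group G] [TopologicalSpace G] [IsTopologicalGroup G]
    [CompactSpace G] [T2Space G] [MeasurableSpace G] [BorelSpace G]
    (F : Submodule ℂ (StrongDual ℂ X)) (α : G →* (X ≃⋆ₐ[ℂ] X)) (hα : IsFDynamicalSystem F α) :
    (∀ π ∈ spec F α, IsFPrime (fixedAlgebra α π.rep ⊤)) ↔
      (IsActionPrime α ∧ spec F α = connesSpectrum F α) :=
  theorem4p3_general F α hα
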